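/- **Setting.** Let $r\ge 1$ be an integer and let $D\subset\mathbb R^2$ be an open rectangle. A *piecewise $C^r$ expanding map* $F:D\to D$ is given as follows. Let $\alpha_1,\dots,\alpha_u$ be finitely many simple regular $C^r$ curves in $\overline D$ that are the edges of a graph all of whose degree-one vertices lie on $\partial D$. Let $D_1,\dots,D_p$ be the connected components of $D'=D\setminus(\alpha_1\cup\dots\cup\alpha_u)$. Then $F$ is a map $D'\to D$ for which there is a constant $\lambda>1$ such that every $F|_{D_i}$ extends to a $C^r$ diffeomorphism $F_i$ from an open neighbourhood of $\overline{D_i}$ onto its image with $\|DF_i(x)v\|\ge\lambda\|v\|$ for all $x$ in the neighbourhood and all $v\in\mathbb R^2$. Such maps $F_\sigma$, with equally many curves and pieces for all $\sigma$, *$C^r$-converge* to $F_0$ if, for a suitable labelling, the curves converge in $C^r([0,1])$ for suitable parametrizations, the pieces converge in the Hausdorff distance, and, for each $i$, the restrictions to the $i$-th pieces have uniformly expanding extensions as above (with a common $\lambda>1$ for all small $\sigma$) to one common neighbourhood which converge there uniformly together with all derivatives of order at most $r$. For $U\subset D$ let $F^n(U)$ be the image under $F^n$ of the points of $U$ at which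 $F^n$ is defined; $U$ is *wandering* if $F^m(U)\cap F^n(U)=\emptyset$ for all integers $m\ne n$, $m,n\ge0$. For $x\in D$ whose whole forward orbit lies in $D'$ and for $v\in\mathbb R^2\setminus\{0\}$, let $\omega(\mathcal A_F(x,v))$ be the set of all $a\in\mathbb R$ such that, for all $\varepsilon>0$ and $n_0$, some $n>n_0$ satisfies $\left|\tfrac1n\log\|DF^n(x)v\|-a\right|<\varepsilon$. Such a point $x$ is *Lyapunov irregular* if $\omega(\mathcal A_F(x,v))$ is not a one-point set for some $v\neq 0$. **Theorem A.** For every integer $r$ with $1\le r<\infty$ there are an open rectangle $D\subset\mathbb R^2$, a one-parameter family of piecewise $C^r$ expanding maps $F_\sigma:D\to D$ $(0<\sigma<1)$ which $C^r$-converge, as $\sigma\to0$, to another piecewise $C^r$ expanding map $F_0:D\to D$ (that is, $F_0\ne F_\sigma$ for all $\sigma$), open rectangles $R_\sigma\subset D$, a constant $\rho>0$ and a real number $c$ (both independent of $\sigma$) such that, for every $0<\sigma<1$, the rectangle $R_\sigma$ is wandering for $F_\sigma$ and, for Lebesgue-almost every $x\in R_\sigma$, the whole forward orbit of $x$ under $F_\sigma$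 is defined and, for every $v\in\mathbb R^2\setminus\{0\}$: - $\omega(\mathcal A_{F_\sigma}(x,v))$ is a compact interval $[a,b]$ with $a<b$; - $\inf\omega(\mathcal A_{F_\sigma}(x,v))\ge\rho$. Moreover, these intervals converge to the one-point set $\{c\}$ as $\sigma\to0$: for every $\varepsilon>0$ there is $\sigma_0>0$ such that, for all $0<\sigma<\sigma_0$, $\omega(\mathcal A_{F_\sigma}(x,v))\subset(c-\varepsilon,c+\varepsilon)$ for almost every $x\in R_\sigma$ and every $v\ne0$. In particular, for every $0<\sigma<1$ the rectangle $D$ contains a Lebesgue measurable set of positive measure consisting of Lyapunov irregular points of $F_\sigma$. -/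

import Mathlib

open Set Filter Topology MeasureTheory

/-- The Euclidean plane. -/
abbrev Plane : Type := EuclideanSpace ℝ (Fin 2)

/-- A nonempty open rectangle `(a, b) × (c, d)` in the plane. -/
def IsOpenRectangle (D : Set Plane) : Prop :=
  ∃ a b c d : ℝ, a < b ∧ c < d ∧ D = {x : Plane | x 0 ∈ Ioo a b ∧ x 1 ∈ Ioo c d}

/-- The data of a piecewise defined planar map: `u` curves, each parametrized by `[0, 1]`,
`p` pieces, and the map itself. Only the values of `toFun` on the pieces are meaningful. -/
structure PiecewiseMap (u p : ℕ) where
  curve : Fin u → ℝ → Plane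
  piece : Fin p → Set Plane
  toFun : Plane → Plane

/-- The domain `D' = D \ (α₁ ∪ ⋯ ∪ α_u)` on which the map is defined. -/
def PiecewiseMap.dom {u p : ℕ} (F : PiecewiseMap u p) (D : Set Plane) : Set Plane :=
  D \ ⋃ j, F.curve j '' Icc (0 : ℝ) 1

/-- `α : [0, 1] → ℝ²` is a simple regular `C^r` curve. -/
structure IsSimpleRegularCurve (r : ℕ) (α : ℝ → Plane) : Prop where
  contDiffOn : ContDiffOn ℝ r α (Icc 0 1)
  injOn : InjOn α (Icc 0 1)
  regular : ∀ t ∈ Icc (0 : ℝ) 1, derivWithin α (Icc 0 1) t ≠ 0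

/-- `G` is an extension of `f|_P` to a `C^r` diffeomorphism from the open neighbourhood `N` of the
closure of `P` onto its image, which expands all tangent vectors by at least the factor `lam`.
(For `lam > 0` and `1 ≤ r` the derivative of `G` is invertible on `N`, so an injective `C^r` map
is a diffeomorphism onto its open image, with `C^r` inverse, by the inverse function theorem.) -/
structure IsExpandingExtension (r : ℕ) (lam : ℝ) (f : Plane → Plane) (P N : Set Plane)
    (G : Plane → Plane) : Prop where
  isOpen : IsOpen N
  closure_subset : closure P ⊆ N
  eqOn : EqOn G f P
  contDiffOn : ContDiffOn ℝ r G N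
  injOn : InjOn G N
  expanding : ∀ x ∈ N, ∀ v : Plane, lam * ‖v‖ ≤ ‖fderiv ℝ G x v‖

/-- `F` is a piecewise `C^r` expanding map on the (rectangular) domain `D`. -/
structure IsPiecewiseExpanding {u p : ℕ} (r : ℕ) (D : Set Plane) (F : PiecewiseMap u p) :
    Prop where
  /-- the `α_j` are simple regular `C^r` curves in the closure of `D` -/
  curve_regular : ∀ j, IsSimpleRegularCurve r (F.curve j)
  curve_subset : ∀ j, F.curve j '' Icc (0 : ℝ) 1 ⊆ closure D
  /-- the curves are the edges of a graph: the interior of a curve meets no other curve -/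
  curve_disjoint : ∀ i j, i ≠ j →
    Disjoint (F.curve i '' Ioo (0 : ℝ) 1) (F.curve j '' Icc (0 : ℝ) 1)
  /-- a vertex of the graph that is not on the boundary of `D` does not have degree one:
  it is also another end of some curve -/
  vertex_degree : ∀ j, ∀ e ∈ ({0, 1} : Set ℝ), F.curve j e ∉ frontier D →
    ∃ i, ∃ e' ∈ ({0, 1} : Set ℝ), (i, e') ≠ (j, e) ∧ F.curve i e' = F.curve j e
  /-- the pieces are the connected components of `D'`, listed without repetition -/
  piece_injective : Function.Injective F.piece
  piece_range : range F.piece = {S | ∃ x ∈ F.dom D, S = connectedComponentIn (F.dom D) x}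
  /-- `F` maps `D'` to `D` -/
  mapsTo : MapsTo F.toFun (F.dom D) D
  /-- uniformly expanding extensions to neighbourhoods of the closures of the pieces -/
  extension : ∃ lam : ℝ, 1 < lam ∧ ∀ i, ∃ (N : Set Plane) (G : Plane → Plane),
    IsExpandingExtension r lam F.toFun (F.piece i) N G

/-- `C^r` convergence, along a filter `l`, of piecewise `C^r` expanding maps (with the same number
of curves and pieces, matched by their labels): the curves converge in `C^r([0, 1])`, the pieces
converge in the Hausdorff distance, and the restrictions to the `i`-th pieces have expanding
extensions to one common neighbourhood that converge there uniformly together with all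
derivatives of order at most `r`. -/
structure CrTendsto {ι : Type*} {u p : ℕ} (r : ℕ) (F : ι → PiecewiseMap u p) (l : Filter ι)
    (F₀ : PiecewiseMap u p) : Prop where
  curve : ∀ j, ∀ k ≤ r, TendstoUniformlyOn
    (fun σ => iteratedDerivWithin k ((F σ).curve j) (Icc 0 1))
    (iteratedDerivWithin k (F₀.curve j) (Icc 0 1)) l (Icc 0 1)
  piece : ∀ i, Tendsto
    (fun σ => Metric.hausdorffDist (closure ((F σ).piece i)) (closure (F₀.piece i))) l (𝓝 0)
  map : ∀ i, ∃ (lam : ℝ) (N : Set Plane) (G : ι → Plane → Plane) (G₀ : Plane → Plane), 1 < lam ∧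
    IsExpandingExtension r lam F₀.toFun (F₀.piece i) N G₀ ∧
    (∀ᶠ σ in l, IsExpandingExtension r lam (F σ).toFun ((F σ).piece i) N (G σ)) ∧
    ∀ k ≤ r, TendstoUniformlyOn (fun σ => iteratedFDeriv ℝ k (G σ)) (iteratedFDeriv ℝ k G₀) l N

/-- The image `F^n(U)`: the image under `F^n` of those points of `U` at which `F^n` is defined. -/
def PiecewiseMap.iterImage {u p : ℕ} (F : PiecewiseMap u p) (D : Set Plane) (n : ℕ)
    (U : Set Plane) : Set Plane :=
  F.toFun^[n] '' {x ∈ U | ∀ k < n, F.toFun^[k] x ∈ F.dom D}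

/-- The forward images `U, F(U), F²(U), …` are pairwise disjoint. -/
def PiecewiseMap.IsWandering {u p : ℕ} (F : PiecewiseMap u p) (D U : Set Plane) : Prop :=
  ∀ m n : ℕ, m ≠ n → Disjoint (F.iterImage D m U) (F.iterImage D n U)

/-- The set `⋂ₙ F^{-n}(D')` of the points of `D` whose whole forward orbit is defined. -/
def PiecewiseMap.regularPoints {u p : ℕ} (F : PiecewiseMap u p) (D : Set Plane) : Set Plane :=
  {x | ∀ n : ℕ, F.toFun^[n] x ∈ F.dom D}

/-- The `ω`-limit set of a real sequence. -/
def omegaLimitSeq (a : ℕ → ℝ) : Set ℝ :=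
  {c | ∀ ε > 0, ∀ n₀ : ℕ, ∃ n > n₀, a n ∈ Ioo (c - ε) (c + ε)}

/-- The sequence `(1/n) log ‖DFⁿ(x) v‖`. -/
noncomputable def PiecewiseMap.lyapSeq {u p : ℕ} (F : PiecewiseMap u p) (x v : Plane) (n : ℕ) :
    ℝ :=
  (1 / (n : ℝ)) * Real.log ‖fderiv ℝ (F.toFun^[n]) x v‖

/-- `x` is a Lyapunov irregular point of `F`. -/
def PiecewiseMap.IsLyapunovIrregular {u p : ℕ} (F : PiecewiseMap u p) (D : Set Plane)
    (x : Plane) : Prop :=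
  x ∈ F.regularPoints D ∧ ∃ v : Plane, v ≠ 0 ∧ ¬ ∃ c, omegaLimitSeq (F.lyapSeq x v) = {c}

/-! The rectangle D = (0,2) × (-1,2) is cut along x = 1, y = 0 and y = 1. For x < 1 the map is (x,
y) ↦ (λx, f(y) + h(x)), where f folds the vertical direction with slopes ±μ; for x > 1 it is (f(y) +
h(x), λ(x - 1)), with the coordinates exchanged. The limit map has μ = λ and h = 0; the perturbed
maps have μ = λ^(1+σ) and a C^r-small h.

Where h is locally constant the derivative is diagonal with entries λ and ±μ, followed by the
exchange when x > 1. A coordinate vector is therefore stretched by λ or by μ, and each visit to x >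
1 switches the two roles. If the visits occur at the ends of excursions of lengths N·4^m, the
proportion of time spent in one role is infinitely often at least 3/4 and infinitely often at most
1/4, so the averaged logarithms diverge (`omegaLimitSeq_growth`). For a vector with two nonzero
components the larger of the two counts decides; its proportion is infinitely often at least 3/4 and
infinitely often 1/2. The increments of the averages tend to 0, so the limit sets are intervals;
they lie in [log λ, log μ], which shrinks to log λ.

It remains to steer a rectangle through such excursions. During an excursion x grows by the factor λ
per step until it exceeds 1, and at each time the rectangle lies over its own window of the x-axis.
The windows are disjoint, so h may take a prescribed value on each of them (`exists_bump_series`),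
and the rectangle is wandering. Folding at y = 0 followed by recentring through h multiplies the
height by μ/2. At the last step h puts the folded coordinate at the starting abscissa of the next
excursion, and the exchange turns the thin height into the new width. To separate the windows of
different excursions, the exit abscissae 1 + `gap m` are distinct; hence an excursion starts at a
positive height and first climbs for `esc m` steps to y = 1, beyond which the outer branch of the
fold brings it back to 0.

A bump of height H over a window of radius w costs |H| / w^r in C^r. Since λ^(64(r+6)) = 2, repeated
halving beats all powers of λ that occur, and a step of an excursion of length d costs at most a
constant times λ^(-3d) (`shift_div_le`). The sum over all steps is small once N is large. -/

/-! ### Smooth functions with prescribed values on disjoint windows -/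

/-- Bounds on the derivatives of a rescaled bump function. -/
theorem norm_iteratedFDeriv_rescale_le {r : ℕ} {φ : ℝ → ℝ} (hφ : ContDiff ℝ r φ) {C : ℝ}
    (hC : ∀ k ≤ r, ∀ x, ‖iteratedFDeriv ℝ k φ x‖ ≤ C) {w : ℝ} (hw : 0 < w)
    (hw1 : w ≤ 1) (z H : ℝ) {k : ℕ} (hk : k ≤ r) (x : ℝ) :
    ‖iteratedFDeriv ℝ k (fun x => H * φ (w⁻¹ * (x - z))) x‖ ≤ C * (|H| / w ^ r) := by
  have h1 : iteratedDeriv k (fun x => H * φ (w⁻¹ * (x - z))) x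
      = H * (w⁻¹ ^ k * iteratedDeriv k φ (w⁻¹ * (x - z))) := by
    rw [iteratedDeriv_const_mul_field]
    have h2 := iteratedDeriv_comp_sub_const (n := k) (f := fun x => φ (w⁻¹ * x)) (s := z)
    have h3 := congrFun h2 x
    rw [h3, iteratedDeriv_comp_const_mul (hφ.of_le (by exact_mod_cast hk))]
  rw [norm_iteratedFDeriv_eq_norm_iteratedDeriv, h1, norm_mul, norm_mul,
    ← norm_iteratedFDeriv_eq_norm_iteratedDeriv, Real.norm_eq_abs]
  have h4 : ‖w⁻¹ ^ k‖ ≤ (w ^ r)⁻¹ := by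
    rw [norm_pow, norm_inv, Real.norm_eq_abs, abs_of_pos hw, ← inv_pow]
    exact pow_le_pow_right₀ (one_le_inv₀ hw |>.2 hw1) hk
  calc |H| * (‖w⁻¹ ^ k‖ * ‖iteratedFDeriv ℝ k φ (w⁻¹ * (x - z))‖)
      ≤ |H| * ((w ^ r)⁻¹ * C) := by
        gcongr
        exact hC k hk _
    _ = C * (|H| / w ^ r) := by ring

/-- A `C^r` function taking prescribed constant values on a sequence of disjoint windows. -/
theorem exists_bump_series (r : ℕ) : ∃ C : ℝ, 0 < C ∧ ∀ (z w H : ℕ → ℝ),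
    (∀ n, 0 < w n) → (∀ n, w n ≤ 1) → Summable (fun n => |H n| / w n ^ r) →
    (∀ m n x, |x - z m| < w m → |x - z n| < w n → m = n) →
    ∃ h : ℝ → ℝ, ContDiff ℝ r h ∧
      (∀ k ≤ r, ∀ x, ‖iteratedFDeriv ℝ k h x‖ ≤ C * ∑' n, |H n| / w n ^ r) ∧
      (∀ n x, |x - z n| ≤ w n / 2 → h x = H n) ∧
      (∀ x, h x = 0 ∨ ∃ n, |x - z n| < w n ∧ ∃ t ∈ Icc (0 : ℝ) 1, h x = t * H n) := by
  -- Inner radius 1/2 and outer radius 1: the rescaled bump is 1 on the half window and vanishes off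
  -- the window.
  let φ : ContDiffBump (0 : ℝ) := ⟨1 / 2, 1, by norm_num, by norm_num⟩
  have hφ : ContDiff ℝ r φ := φ.contDiff
  have hb : ∀ k : ℕ, ∃ C, ∀ x, ‖iteratedFDeriv ℝ k φ x‖ ≤ C := fun k =>
    (φ.hasCompactSupport.iteratedFDeriv k).exists_bound_of_continuous
      ((φ.contDiff (n := (k : ℕ∞))).continuous_iteratedFDeriv (by simp))
  choose C hC using hb
  have hC0 : ∀ k, 0 ≤ C k := fun k => (norm_nonneg _).trans (hC k 0)
  -- One bound for all orders up to `r`; the summand 1 makes it positive.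
  set K : ℝ := 1 + ∑ k ∈ Finset.range (r + 1), C k with hK
  have hKle : ∀ k ≤ r, ∀ x, ‖iteratedFDeriv ℝ k φ x‖ ≤ K := by
    intro k hk x
    have := Finset.single_le_sum (f := C) (fun i _ => hC0 i)
      (Finset.mem_range.2 (Nat.lt_succ_of_le hk))
    linarith [hC k x]
  have hKpos : 0 < K := by
    have := Finset.sum_nonneg (s := Finset.range (r + 1)) (f := C) (fun i _ => hC0 i)
    linarith
  refine ⟨K, hKpos, fun z w H hw hw1 hsum hdisj => ?_⟩
  set f : ℕ → ℝ → ℝ := fun n x => H n * φ ((w n)⁻¹ * (x - z n)) with hf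
  have hfc : ∀ n, ContDiff ℝ r (f n) := fun n =>
    contDiff_const.mul (hφ.comp (contDiff_const.mul (contDiff_id.sub contDiff_const)))
  have hfb : ∀ k ≤ r, ∀ n x, ‖iteratedFDeriv ℝ k (f n) x‖ ≤ K * (|H n| / w n ^ r) :=
    fun k hk n x => norm_iteratedFDeriv_rescale_le hφ hKle (hw n) (hw1 n) _ _ hk x
  have hsum' : Summable fun n => K * (|H n| / w n ^ r) := hsum.mul_left K
  have hzero : ∀ n x, ¬ |x - z n| < w n → f n x = 0 := by
    intro n x hx
    have : φ ((w n)⁻¹ * (x - z n)) = 0 := by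
      apply φ.zero_of_le_dist
      rw [Real.dist_eq, sub_zero, abs_mul, abs_of_pos (inv_pos.2 (hw n)), inv_mul_eq_div]
      exact (one_le_div (hw n)).2 (not_lt.1 hx)
    simp [hf, this]
  have hsingle : ∀ n x, |x - z n| < w n → ∑' i, f i x = f n x := by
    intro n x hx
    apply tsum_eq_single
    intro i hi
    exact hzero i x fun h => hi (hdisj i n x h hx)
  have hd := contDiff_tsum (𝕜 := ℝ) (N := (r : ℕ∞)) (f := f)
    (v := fun _ n => K * (|H n| / w n ^ r)) hfc (fun _ _ => hsum')
    (fun k n x hk => hfb k (by exact_mod_cast hk) n x)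
  refine ⟨fun x => ∑' n, f n x, hd, ?_, ?_, ?_⟩
  · intro k hk x
    rw [iteratedFDeriv_tsum (𝕜 := ℝ) (N := (r : ℕ∞)) (f := f)
      (v := fun _ n => K * (|H n| / w n ^ r)) hfc (fun _ _ => hsum')
      (fun k n x hk => hfb k (by exact_mod_cast hk) n x) (by exact_mod_cast hk), ← tsum_mul_left]
    exact tsum_of_norm_bounded hsum'.hasSum fun n => hfb k hk n x
  · intro n x hx
    have hx' : |x - z n| < w n := lt_of_le_of_lt hx (by linarith [hw n])
    simp only [hsingle n x hx']
    have : φ ((w n)⁻¹ * (x - z n)) = 1 := by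
      apply φ.one_of_mem_closedBall
      rw [mem_closedBall_zero_iff, Real.norm_eq_abs, abs_mul, abs_of_pos (inv_pos.2 (hw n)),
        inv_mul_eq_div]
      change _ ≤ (1 / 2 : ℝ)
      rw [div_le_iff₀ (hw n)]
      linarith
    simp [hf, this]
  · intro x
    by_cases hx : ∃ n, |x - z n| < w n
    · obtain ⟨n, hn⟩ := hx
      refine Or.inr ⟨n, hn, φ ((w n)⁻¹ * (x - z n)), ⟨φ.nonneg, φ.le_one⟩, ?_⟩
      simp only [hsingle n x hn]
      simp [hf, mul_comm]
    · left
      push Not at hx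
      have : ∀ n, f n x = 0 := fun n => hzero n x (not_lt.2 (hx n))
      simp [this]

/-! ### Limit sets of real sequences -/

theorem omegaLimitSeq_subset_Icc {a : ℕ → ℝ} {A B : ℝ}
    (hA : ∀ ε > 0, ∀ᶠ n in atTop, A - ε ≤ a n) (hB : ∀ ε > 0, ∀ᶠ n in atTop, a n ≤ B + ε) :
    omegaLimitSeq a ⊆ Icc A B := by
  intro c hc
  constructor
  · by_contra h
    push Not at h
    obtain ⟨n₀, h₀⟩ := eventually_atTop.1 (hA ((A - c) / 2) (by linarith))
    obtain ⟨n, hn, hn'⟩ := hc ((A - c) / 2) (by linarith) n₀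
    have := h₀ n hn.le
    linarith [hn'.2]
  · by_contra h
    push Not at h
    obtain ⟨n₀, h₀⟩ := eventually_atTop.1 (hB ((c - B) / 2) (by linarith))
    obtain ⟨n, hn, hn'⟩ := hc ((c - B) / 2) (by linarith) n₀
    have := h₀ n hn.le
    linarith [hn'.1]

/-- A sequence whose increments tend to zero visits every neighbourhood of a point between two
values that it crosses infinitely often. -/
theorem mem_omegaLimitSeq_of_frequently {a : ℕ → ℝ}
    (hd : Tendsto (fun n => a (n + 1) - a n) atTop (𝓝 0)) {c : ℝ}
    (hlo : ∀ ε > 0, ∃ᶠ n in atTop, a n < c + ε) (hhi : ∀ ε > 0, ∃ᶠ n in atTop, c - ε < a n) :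
    c ∈ omegaLimitSeq a := by
  intro ε hε n₀
  have h0 : ∀ᶠ n in atTop, |a (n + 1) - a n| < ε := by
    have := (Metric.tendsto_atTop.1 hd) ε hε
    obtain ⟨N, hN⟩ := this
    filter_upwards [eventually_ge_atTop N] with n hn
    simpa [Real.dist_eq] using hN n hn
  obtain ⟨N, hN⟩ := eventually_atTop.1 h0
  obtain ⟨m, hm, hmlo⟩ := frequently_atTop.1 (hlo ε hε) (max N (n₀ + 1))
  have hmN : N ≤ m := le_trans (le_max_left _ _) hm
  have hmn : n₀ < m := lt_of_lt_of_le (Nat.lt_succ_self _) (le_trans (le_max_right _ _) hm)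
  have hex : ∃ n, m ≤ n ∧ c - ε < a n := by
    obtain ⟨n, hn, hn'⟩ := frequently_atTop.1 (hhi ε hε) m
    exact ⟨n, hn, hn'⟩
  classical
  -- At the first index from `m` on with value above `c - ε`, either the index is `m` itself or the
  -- previous value is at most `c - ε`, and a jump smaller than `ε` cannot pass `c + ε`.
  set n := Nat.find hex with hn
  obtain ⟨hmn', hlow⟩ := Nat.find_spec hex
  refine ⟨n, lt_of_lt_of_le hmn hmn', hlow, ?_⟩
  rcases eq_or_lt_of_le hmn' with h | h
  · rw [hn, ← h]
    exact hmlo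
  · obtain ⟨j, hj⟩ : ∃ j, n = j + 1 := ⟨n - 1, by omega⟩
    have hj' := Nat.find_min hex (m := j) (by omega)
    push Not at hj'
    have h1 := hj' (by omega)
    have h2 := hN j (by omega)
    have h3 := (abs_lt.1 h2).2
    rw [hj]
    linarith

/-- The limit set of a bounded divergent sequence whose increments tend to zero is a nontrivial
compact interval. -/
theorem omegaLimitSeq_eq_Icc {a : ℕ → ℝ} {A B : ℝ} (hA : ∀ᶠ n in atTop, A ≤ a n)
    (hB : ∀ᶠ n in atTop, a n ≤ B) (hd : Tendsto (fun n => a (n + 1) - a n) atTop (𝓝 0))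
    (hdiv : ¬ ∃ c, Tendsto a atTop (𝓝 c)) : ∃ s t : ℝ, s < t ∧ omegaLimitSeq a = Icc s t := by
  have hbA : IsBoundedUnder (· ≥ ·) atTop a := ⟨A, by simpa using hA⟩
  have hbB : IsBoundedUnder (· ≤ ·) atTop a := ⟨B, by simpa using hB⟩
  have hle : liminf a atTop ≤ limsup a atTop := liminf_le_limsup hbB hbA
  refine ⟨liminf a atTop, limsup a atTop, lt_of_le_of_ne hle fun h => hdiv
    ⟨_, tendsto_of_liminf_eq_limsup rfl h.symm hbB hbA⟩, ?_⟩
  apply Subset.antisymm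
  · apply omegaLimitSeq_subset_Icc
    · intro ε hε
      exact (eventually_lt_of_lt_liminf (by linarith) hbA).mono fun n hn => le_of_lt hn
    · intro ε hε
      exact (eventually_lt_of_limsup_lt (by linarith) hbB).mono fun n hn => le_of_lt hn
  · intro c hc
    apply mem_omegaLimitSeq_of_frequently hd
    · intro ε hε
      exact frequently_lt_of_liminf_lt hbB.isCoboundedUnder_ge (by linarith [hc.1])
    · intro ε hε
      exact frequently_lt_of_lt_limsup hbA.isCoboundedUnder_le (by linarith [hc.2])

/-! ### The ambient rectangle and its grid -/

/-- The open rectangle `(a, b) × (c, d)`. -/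
def openRect (a b c d : ℝ) : Set Plane := {z | z 0 ∈ Ioo a b ∧ z 1 ∈ Ioo c d}

/-- The ambient rectangle `(0, 2) × (-1, 2)`. -/
def ambientRect : Set Plane := openRect 0 2 (-1) 2

theorem isOpen_openRect (a b c d : ℝ) : IsOpen (openRect a b c d) :=
  (isOpen_Ioo.preimage (by fun_prop : Continuous fun z : Plane => z 0)).inter
    (isOpen_Ioo.preimage (by fun_prop : Continuous fun z : Plane => z 1))

theorem convex_openRect (a b c d : ℝ) : Convex ℝ (openRect a b c d) := by
  intro x hx y hy s t hs ht hst
  exact ⟨convex_Ioo a b hx.1 hy.1 hs ht hst, convex_Ioo c d hx.2 hy.2 hs ht hst⟩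

theorem closedRect_subset_closure {a b c d : ℝ} (hab : a < b) (hcd : c < d) {z : Plane}
    (h0 : z 0 ∈ Icc a b) (h1 : z 1 ∈ Icc c d) : z ∈ closure (openRect a b c d) := by
  set m : Plane := !₂[(a + b) / 2, (c + d) / 2]
  have hm : Tendsto (fun t : ℝ => (1 - t) • z + t • m) (𝓝[>] 0) (𝓝 z) := by
    have : Continuous fun t : ℝ => (1 - t) • z + t • m := by fun_prop
    have h := this.tendsto 0
    simp only [sub_zero, one_smul, zero_smul, add_zero] at h
    exact h.mono_left nhdsWithin_le_nhds
  refine mem_closure_of_tendsto hm ?_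
  filter_upwards [Ioo_mem_nhdsGT (show (0 : ℝ) < 1 by norm_num)] with t ht
  obtain ⟨ht0, ht1⟩ := ht
  refine ⟨⟨?_, ?_⟩, ?_, ?_⟩ <;>
    simp [m] <;> nlinarith [h0.1, h0.2, h1.1, h1.2, mul_pos ht0 (sub_pos.2 hab),
      mul_pos ht0 (sub_pos.2 hcd)]

theorem closure_openRect_subset_ball {a b c d : ℝ} (ha : -3 ≤ a) (hb : b ≤ 3) (hc : -3 ≤ c)
    (hd : d ≤ 3) : closure (openRect a b c d) ⊆ Metric.ball 0 10 := by
  have : openRect a b c d ⊆ Metric.closedBall 0 9 := by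
    rintro z ⟨⟨h1, h2⟩, h3, h4⟩
    rw [mem_closedBall_zero_iff]
    have hz : ‖z‖ ^ 2 = z 0 ^ 2 + z 1 ^ 2 := by
      rw [EuclideanSpace.norm_sq_eq]; simp [Fin.sum_univ_two]
    nlinarith [norm_nonneg z]
  exact (closure_minimal this Metric.isClosed_closedBall).trans
    (Metric.closedBall_subset_ball (by norm_num))

/-- Starting points of the seven unit edges of the grid `{x = 1} ∪ {y = 0} ∪ {y = 1}`. -/
def edgeStart : Fin 7 → ℝ × ℝ := ![(1, -1), (1, 0), (1, 1), (0, 0), (1, 0), (0, 1), (1, 1)]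

/-- Directions of the edges of the grid. -/
def edgeDir : Fin 7 → ℝ × ℝ := ![(0, 1), (0, 1), (0, 1), (1, 0), (1, 0), (1, 0), (1, 0)]

/-- The edges of the grid. -/
def gridEdge (j : Fin 7) (t : ℝ) : Plane :=
  !₂[(edgeStart j).1 + t * (edgeDir j).1, (edgeStart j).2 + t * (edgeDir j).2]

/-- Abscissae of the left sides of the cells. -/
def cellX : Fin 6 → ℝ := ![0, 0, 0, 1, 1, 1]

/-- Ordinates of the lower sides of the cells. -/
def cellY : Fin 6 → ℝ := ![-1, 0, 1, -1, 0, 1]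

/-- The six unit squares cut out by the grid. -/
def gridCell (i : Fin 6) : Set Plane :=
  openRect (cellX i) (cellX i + 1) (cellY i) (cellY i + 1)

/-- The union of the edges is the union of the three lines. -/
theorem mem_iUnion_gridEdge {z : Plane} (hz : z ∈ ambientRect) :
    z ∈ ⋃ j, gridEdge j '' Icc (0 : ℝ) 1 ↔ z 0 = 1 ∨ z 1 = 0 ∨ z 1 = 1 := by
  obtain ⟨⟨h1, h2⟩, h3, h4⟩ := hz
  constructor
  · intro h
    obtain ⟨j, t, -, rfl⟩ := mem_iUnion.1 h
    fin_cases j <;> simp [gridEdge, edgeStart, edgeDir]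
  · have key : ∀ (j : Fin 7) (t : ℝ), t ∈ Icc (0 : ℝ) 1 → z 0 = gridEdge j t 0 →
        z 1 = gridEdge j t 1 → z ∈ ⋃ j, gridEdge j '' Icc (0 : ℝ) 1 := by
      intro j t ht e0 e1
      refine mem_iUnion.2 ⟨j, t, ht, ?_⟩
      ext i
      fin_cases i
      · exact e0.symm
      · exact e1.symm
    rintro (h | h | h)
    · rcases le_total (z 1) 0 with h5 | h5
      · exact key 0 (z 1 + 1) ⟨by linarith, by linarith⟩ (by simp [gridEdge, edgeStart, edgeDir, h])
          (by simp [gridEdge, edgeStart, edgeDir])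
      rcases le_total (z 1) 1 with h6 | h6
      · exact key 1 (z 1) ⟨by linarith, by linarith⟩ (by simp [gridEdge, edgeStart, edgeDir, h])
          (by simp [gridEdge, edgeStart, edgeDir])
      · exact key 2 (z 1 - 1) ⟨by linarith, by linarith⟩
          (by simp [gridEdge, edgeStart, edgeDir, h]) (by simp [gridEdge, edgeStart, edgeDir])
    · rcases le_total (z 0) 1 with h5 | h5
      · exact key 3 (z 0) ⟨by linarith, by linarith⟩ (by simp [gridEdge, edgeStart, edgeDir])
          (by simp [gridEdge, edgeStart, edgeDir, h])
      · exact key 4 (z 0 - 1) ⟨by linarith, by linarith⟩ (by simp [gridEdge, edgeStart, edgeDir])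
          (by simp [gridEdge, edgeStart, edgeDir, h])
    · rcases le_total (z 0) 1 with h5 | h5
      · exact key 5 (z 0) ⟨by linarith, by linarith⟩ (by simp [gridEdge, edgeStart, edgeDir])
          (by simp [gridEdge, edgeStart, edgeDir, h])
      · exact key 6 (z 0 - 1) ⟨by linarith, by linarith⟩ (by simp [gridEdge, edgeStart, edgeDir])
          (by simp [gridEdge, edgeStart, edgeDir, h])

theorem gridEdge_isSimpleRegularCurve (r : ℕ) (j : Fin 7) :
    IsSimpleRegularCurve r (gridEdge j) := by
  have hd : ∀ t, HasDerivAt (gridEdge j) !₂[(edgeDir j).1, (edgeDir j).2] t := by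
    intro t
    have h1 : gridEdge j = fun t => !₂[(edgeStart j).1, (edgeStart j).2]
        + t • (!₂[(edgeDir j).1, (edgeDir j).2] : Plane) := by
      funext t
      ext i
      fin_cases i <;> simp [gridEdge]
    rw [h1]
    simpa using ((hasDerivAt_id t).smul_const (!₂[(edgeDir j).1, (edgeDir j).2] : Plane)).const_add
      (!₂[(edgeStart j).1, (edgeStart j).2] : Plane)
  refine ⟨?_, ?_, ?_⟩
  · apply ContDiff.contDiffOn
    rw [contDiff_euclidean]
    intro i
    fin_cases i
    · exact contDiff_const.add (contDiff_id.mul contDiff_const)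
    · exact contDiff_const.add (contDiff_id.mul contDiff_const)
  · intro s _ t _ h
    have h0 := congrArg (fun z : Plane => z 0) h
    have h1 := congrArg (fun z : Plane => z 1) h
    fin_cases j <;> simp [gridEdge, edgeStart, edgeDir] at h0 h1 <;> assumption
  · intro t ht
    rw [(hd t).hasDerivWithinAt.derivWithin (uniqueDiffOn_Icc zero_lt_one t ht)]
    intro h
    have h0 := congrArg (fun z : Plane => z 0) h
    have h1 := congrArg (fun z : Plane => z 1) h
    fin_cases j <;> simp [edgeDir] at h0 h1

theorem gridEdge_image_subset (j : Fin 7) :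
    gridEdge j '' Icc (0 : ℝ) 1 ⊆ closure ambientRect := by
  rintro _ ⟨t, ⟨h0, h1⟩, rfl⟩
  apply closedRect_subset_closure (by norm_num) (by norm_num)
  · constructor <;> fin_cases j <;> simp [gridEdge, edgeStart, edgeDir] <;> linarith
  · constructor <;> fin_cases j <;> simp [gridEdge, edgeStart, edgeDir] <;> linarith

theorem gridEdge_disjoint {i j : Fin 7} (hij : i ≠ j) :
    Disjoint (gridEdge i '' Ioo (0 : ℝ) 1) (gridEdge j '' Icc (0 : ℝ) 1) := by
  rw [Set.disjoint_left]
  rintro _ ⟨s, ⟨hs0, hs1⟩, rfl⟩ ⟨t, ⟨ht0, ht1⟩, h⟩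
  have e0 := congrArg (fun z : Plane => z 0) h
  have e1 := congrArg (fun z : Plane => z 1) h
  simp only [gridEdge, PiLp.toLp_apply, Matrix.cons_val_zero, Matrix.cons_val_one] at e0 e1
  fin_cases i <;> fin_cases j <;>
    first
    | exact absurd rfl hij
    | (simp [edgeStart, edgeDir] at e0 e1 <;> linarith)

theorem notMem_frontier_ambientRect {z : Plane} (hz : z ∈ closure ambientRect)
    (hf : z ∉ frontier ambientRect) : z ∈ ambientRect := by
  have ho : IsOpen ambientRect := isOpen_openRect _ _ _ _
  rw [ho.frontier_eq] at hf
  by_contra h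
  exact hf ⟨hz, h⟩

theorem gridEdge_vertex (j : Fin 7) (e : ℝ) (he : e ∈ ({0, 1} : Set ℝ))
    (hf : gridEdge j e ∉ frontier ambientRect) :
    ∃ i, ∃ e' ∈ ({0, 1} : Set ℝ), (i, e') ≠ (j, e) ∧ gridEdge i e' = gridEdge j e := by
  have he' : e ∈ Icc (0 : ℝ) 1 := by
    rcases he with rfl | rfl <;> simp
  obtain ⟨⟨h1, h2⟩, h3, h4⟩ :=
    notMem_frontier_ambientRect (gridEdge_image_subset j ⟨e, he', rfl⟩) hf
  have key : ∀ (i : Fin 7) (e' : ℝ), e' ∈ ({0, 1} : Set ℝ) → i ≠ j →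
      gridEdge i e' = gridEdge j e →
      ∃ i, ∃ e' ∈ ({0, 1} : Set ℝ), (i, e') ≠ (j, e) ∧ gridEdge i e' = gridEdge j e :=
    fun i e' h h' h'' => ⟨i, e', h, fun h => h' (Prod.ext_iff.1 h).1, h''⟩
  have m0 : (0 : ℝ) ∈ ({0, 1} : Set ℝ) := by simp
  have m1 : (1 : ℝ) ∈ ({0, 1} : Set ℝ) := by simp
  rcases he with rfl | rfl <;> fin_cases j <;>
    simp [gridEdge, edgeStart, edgeDir] at h1 h2 h3 h4 <;>
    first | (norm_num at h4; done) | (norm_num at h2; done) | skip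
  -- Eight edge ends remain, all at the interior vertices (1,0) and (1,1); each is matched with an
  -- end of another edge on the vertical line.
  · exact key 0 1 m1 (by decide) (by simp [gridEdge, edgeStart, edgeDir])
  · exact key 1 1 m1 (by decide) (by norm_num [gridEdge, edgeStart, edgeDir])
  · exact key 0 1 m1 (by decide) (by simp [gridEdge, edgeStart, edgeDir])
  · exact key 1 1 m1 (by decide) (by norm_num [gridEdge, edgeStart, edgeDir])
  · exact key 1 0 m0 (by decide) (by simp [gridEdge, edgeStart, edgeDir])
  · exact key 2 0 m0 (by decide) (by simp [gridEdge, edgeStart, edgeDir])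
  · exact key 1 0 m0 (by decide) (by simp [gridEdge, edgeStart, edgeDir])
  · exact key 2 0 m0 (by decide) (by simp [gridEdge, edgeStart, edgeDir])

/-- Connected components of a set that is a disjoint union of open connected sets. -/
theorem components_eq_range {X ι : Type*} [TopologicalSpace X] {S : Set X} {P : ι → Set X}
    (hS : S = ⋃ i, P i) (hopen : ∀ i, IsOpen (P i)) (hconn : ∀ i, IsPreconnected (P i))
    (hne : ∀ i, (P i).Nonempty) (hdisj : ∀ i j x, x ∈ P i → x ∈ P j → i = j) :
    range P = {T | ∃ x ∈ S, T = connectedComponentIn S x} := by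
  have key : ∀ i, ∀ x ∈ P i, P i = connectedComponentIn S x := by
    intro i x hx
    have hPS : P i ⊆ S := hS ▸ subset_iUnion P i
    apply Subset.antisymm ((hconn i).subset_connectedComponentIn hx hPS)
    -- The component meets the open set `P i`; the union of the other pieces is open and disjoint
    -- from it, so connectedness excludes them.
    refine isPreconnected_connectedComponentIn.subset_left_of_subset_union (hopen i)
      (isOpen_biUnion fun j (_ : j ≠ i) => hopen j) ?_ ?_
      ⟨x, mem_connectedComponentIn (hPS hx), hx⟩
    · rw [Set.disjoint_left]
      intro y hy hy'
      obtain ⟨j, hj, hyj⟩ := mem_iUnion₂.1 hy'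
      exact hj (hdisj j i y hyj hy)
    · intro y hy
      have : y ∈ ⋃ i, P i := hS ▸ connectedComponentIn_subset S x hy
      obtain ⟨j, hj⟩ := mem_iUnion.1 this
      by_cases hji : j = i
      · exact Or.inl (hji ▸ hj)
      · exact Or.inr (mem_iUnion₂.2 ⟨j, hji, hj⟩)
  ext T
  constructor
  · rintro ⟨i, rfl⟩
    obtain ⟨x, hx⟩ := hne i
    exact ⟨x, hS ▸ mem_iUnion.2 ⟨i, hx⟩, key i x hx⟩
  · rintro ⟨x, hx, rfl⟩
    obtain ⟨i, hi⟩ := mem_iUnion.1 (hS ▸ hx)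
    exact ⟨i, key i x hi⟩

theorem gridCell_unique (i j : Fin 6) (z : Plane) (hi : z ∈ gridCell i) (hj : z ∈ gridCell j) :
    i = j := by
  obtain ⟨⟨a1, a2⟩, a3, a4⟩ := hi
  obtain ⟨⟨b1, b2⟩, b3, b4⟩ := hj
  fin_cases i <;> fin_cases j <;>
    first
    | rfl
    | (exfalso; simp [cellX, cellY] at a1 a2 a3 a4 b1 b2 b3 b4; linarith)

theorem gridCell_nonempty (i : Fin 6) : (gridCell i).Nonempty := by
  refine ⟨!₂[cellX i + 1 / 2, cellY i + 1 / 2], ⟨?_, ?_⟩, ?_, ?_⟩ <;> simp <;> norm_num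

theorem gridCell_subset (i : Fin 6) : gridCell i ⊆ ambientRect := by
  rintro z ⟨⟨a1, a2⟩, a3, a4⟩
  refine ⟨⟨?_, ?_⟩, ?_, ?_⟩ <;> fin_cases i <;> simp [cellX, cellY] at a1 a2 a3 a4 <;> linarith

theorem closure_gridCell_subset (i : Fin 6) : closure (gridCell i) ⊆ Metric.ball 0 10 := by
  apply closure_openRect_subset_ball <;> fin_cases i <;> norm_num [cellX, cellY]

theorem mem_iUnion_gridCell {z : Plane} :
    z ∈ ⋃ i, gridCell i ↔ z ∈ ambientRect ∧ z 0 ≠ 1 ∧ z 1 ≠ 0 ∧ z 1 ≠ 1 := by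
  constructor
  · intro h
    obtain ⟨i, hi⟩ := mem_iUnion.1 h
    refine ⟨gridCell_subset i hi, ?_⟩
    obtain ⟨⟨a1, a2⟩, a3, a4⟩ := hi
    refine ⟨?_, ?_, ?_⟩ <;> intro h <;> fin_cases i <;> simp [cellX, cellY] at a1 a2 a3 a4 <;>
      linarith
  · rintro ⟨⟨⟨a1, a2⟩, a3, a4⟩, h1, h2, h3⟩
    have key : ∀ i, z 0 ∈ Ioo (cellX i) (cellX i + 1) → z 1 ∈ Ioo (cellY i) (cellY i + 1) →
        z ∈ ⋃ i, gridCell i := fun i h h' => mem_iUnion.2 ⟨i, h, h'⟩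
    rcases lt_or_gt_of_ne h1 with b1 | b1 <;> rcases lt_or_gt_of_ne h2 with b2 | b2 <;>
      rcases lt_or_gt_of_ne h3 with b3 | b3
    · exact key 0 (by constructor <;> simp [cellX] <;> linarith)
        (by constructor <;> simp [cellY] <;> linarith)
    · linarith
    · exact key 1 (by constructor <;> simp [cellX] <;> linarith)
        (by constructor <;> simp [cellY] <;> linarith)
    · exact key 2 (by constructor <;> simp [cellX] <;> linarith)
        (by constructor <;> simp [cellY] <;> linarith)
    · exact key 3 (by constructor <;> simp [cellX] <;> linarith)
        (by constructor <;> simp [cellY] <;> linarith)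
    · linarith
    · exact key 4 (by constructor <;> simp [cellX] <;> linarith)
        (by constructor <;> simp [cellY] <;> linarith)
    · exact key 5 (by constructor <;> simp [cellX] <;> linarith)
        (by constructor <;> simp [cellY] <;> linarith)

/-! ### The folding map and its branches -/

/-- The isometry exchanging the two coordinates. -/
noncomputable def swapPlane : Plane ≃ₗᵢ[ℝ] Plane :=
  LinearIsometryEquiv.piLpCongrLeft 2 ℝ ℝ (Equiv.swap 0 1)

theorem swapPlane_apply (v : Plane) : swapPlane v = !₂[v 1, v 0] := by
  ext i; fin_cases i <;> simp [swapPlane, LinearIsometryEquiv.piLpCongrLeft_apply]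

/-- A sheared affine map followed by an isometry. -/
noncomputable def shearMap (ι : Plane ≃ₗᵢ[ℝ] Plane) (lam c s d : ℝ) (h : ℝ → ℝ) (z : Plane) :
    Plane :=
  ι !₂[lam * (z 0 - c), s * (z 1 - d) + h (z 0)]

/-- The linear map with matrix `[[a, 0], [t, s]]`. -/
noncomputable def shearLin (a s t : ℝ) : Plane →L[ℝ] Plane :=
  (a • EuclideanSpace.proj (𝕜 := ℝ) (0 : Fin 2)).smulRight (EuclideanSpace.single (0 : Fin 2) (1 : ℝ))
    + (s • EuclideanSpace.proj (𝕜 := ℝ) (1 : Fin 2)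
      + t • EuclideanSpace.proj (𝕜 := ℝ) (0 : Fin 2)).smulRight
        (EuclideanSpace.single (1 : Fin 2) (1 : ℝ))

theorem shearLin_apply (a s t : ℝ) (v : Plane) :
    shearLin a s t v = !₂[a * v 0, s * v 1 + t * v 0] := by
  ext i; fin_cases i <;> simp [shearLin]

theorem norm_sq_plane (v : Plane) : ‖v‖ ^ 2 = v 0 ^ 2 + v 1 ^ 2 := by
  rw [EuclideanSpace.norm_sq_eq]; simp [Fin.sum_univ_two]

theorem hasFDerivAt_coord (i : Fin 2) (z : Plane) :
    HasFDerivAt (fun z : Plane => z i) (EuclideanSpace.proj (𝕜 := ℝ) i : Plane →L[ℝ] ℝ) z :=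
  (EuclideanSpace.proj (𝕜 := ℝ) i : Plane →L[ℝ] ℝ).hasFDerivAt

theorem shearMap_hasFDerivAt (ι : Plane ≃ₗᵢ[ℝ] Plane) (lam c s d : ℝ) {h : ℝ → ℝ} {z : Plane}
    {t : ℝ} (hh : HasDerivAt h t (z 0)) :
    HasFDerivAt (shearMap ι lam c s d h) ((ι : Plane →L[ℝ] Plane).comp (shearLin lam s t)) z := by
  have h0 := hasFDerivAt_coord 0 z
  have h1 := hasFDerivAt_coord 1 z
  have e0 := ((h0.sub_const c).const_mul lam).smul_const
    (EuclideanSpace.single (0 : Fin 2) (1 : ℝ))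
  have e1 := (((h1.sub_const d).const_mul s).add (hh.comp_hasFDerivAt z h0)).smul_const
    (EuclideanSpace.single (1 : Fin 2) (1 : ℝ))
  have e2 := ι.toContinuousLinearEquiv.hasFDerivAt.comp z (e0.add e1)
  refine e2.congr_of_eventuallyEq (Eventually.of_forall fun y => ?_)
  change ι _ = ι _
  congr 1
  ext i
  fin_cases i <;> simp

theorem shearMap_contDiff (ι : Plane ≃ₗᵢ[ℝ] Plane) (lam c s d : ℝ) {h : ℝ → ℝ} {r : ℕ}
    (hh : ContDiff ℝ r h) : ContDiff ℝ r (shearMap ι lam c s d h) := by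
  refine ι.contDiff.comp ?_
  rw [contDiff_euclidean]
  have hc : ∀ i : Fin 2, ContDiff ℝ r fun z : Plane => z i := fun i =>
    (EuclideanSpace.proj (𝕜 := ℝ) i : Plane →L[ℝ] ℝ).contDiff
  intro i
  fin_cases i
  · exact contDiff_const.mul ((hc 0).sub contDiff_const)
  · exact (contDiff_const.mul ((hc 1).sub contDiff_const)).add (hh.comp (hc 0))

theorem shearMap_injective (ι : Plane ≃ₗᵢ[ℝ] Plane) {lam s : ℝ} (c d : ℝ) (h : ℝ → ℝ)
    (hlam : lam ≠ 0) (hs : s ≠ 0) : Function.Injective (shearMap ι lam c s d h) := by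
  intro x y hxy
  have e := ι.injective hxy
  have e0 := congrArg (fun z : Plane => z 0) e
  have e1 := congrArg (fun z : Plane => z 1) e
  simp [hlam] at e0
  simp [e0, hs] at e1
  ext i
  fin_cases i
  · exact e0
  · exact e1

/-- The diagonal part expands by `lam`, and the off-diagonal entry can destroy at most `(lam - 1) /
2` of this. The remaining factor `(lam + 1) / 2` still exceeds 1, which explains the bound required
of the derivative of `h`. -/
theorem shearLin_expanding {lam s t : ℝ} (hlam : 1 < lam) (hs : lam ≤ |s|)
    (ht : |t| ≤ (lam - 1) / 2) (v : Plane) : (lam + 1) / 2 * ‖v‖ ≤ ‖shearLin lam s t v‖ := by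
  have h1 : shearLin lam s t v = shearLin lam s 0 v + !₂[0, t * v 0] := by
    rw [shearLin_apply, shearLin_apply]
    ext i; fin_cases i <;> simp
  have h2 : lam * ‖v‖ ≤ ‖shearLin lam s 0 v‖ := by
    apply le_of_sq_le_sq _ (norm_nonneg _)
    rw [mul_pow, norm_sq_plane, norm_sq_plane, shearLin_apply]
    simp only [Matrix.cons_val_zero, Matrix.cons_val_one]
    have : lam ^ 2 ≤ s ^ 2 := by
      rw [← sq_abs s]
      exact pow_le_pow_left₀ (by linarith) hs 2
    nlinarith [mul_le_mul_of_nonneg_right this (sq_nonneg (v 1))]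
  have h3 : ‖(!₂[0, t * v 0] : Plane)‖ ≤ (lam - 1) / 2 * ‖v‖ := by
    have e1 : ‖(!₂[0, t * v 0] : Plane)‖ = |t| * |v 0| := by
      rw [EuclideanSpace.norm_eq]
      simp [Fin.sum_univ_two, Real.sqrt_sq_eq_abs, abs_mul]
    rw [e1]
    have : |v 0| ≤ ‖v‖ := PiLp.norm_apply_le v 0
    gcongr
  have h4 := norm_sub_le_norm_add (shearLin lam s 0 v) !₂[0, t * v 0]
  rw [h1]
  linarith

/-- The fold `y ↦ μ |y|` on `(-1, 1)`, continued by `y ↦ μ (y - 1)` on `(1, 2)`. -/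
noncomputable def foldFun (mu y : ℝ) : ℝ :=
  if y < 0 then -mu * y else if y < 1 then mu * y else mu * (y - 1)

/-- The piecewise expanding map: stretch the first coordinate, fold the second one, and exchange
the coordinates on the right half of the rectangle. -/
noncomputable def foldingMap (lam mu : ℝ) (h : ℝ → ℝ) : PiecewiseMap 7 6 where
  curve := gridEdge
  piece := gridCell
  toFun z :=
    if z 0 < 1 then !₂[lam * z 0, foldFun mu (z 1) + h (z 0)]
    else !₂[foldFun mu (z 1) + h (z 0), lam * (z 0 - 1)]

/-- The isometry applied on the cell `i`. -/
noncomputable def cellIso (i : Fin 6) : Plane ≃ₗᵢ[ℝ] Plane :=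
  if i < 3 then LinearIsometryEquiv.refl ℝ Plane else swapPlane

/-- The sign of the slope of the fold on the cell `i`. -/
def cellSign : Fin 6 → ℝ := ![-1, 1, 1, -1, 1, 1]

/-- The end of the cell `i` at which the branch of the fold vanishes. -/
def cellBase : Fin 6 → ℝ := ![0, 0, 1, 0, 0, 1]

/-- The branch of the folding map on the cell `i`. -/
noncomputable def branch (lam mu : ℝ) (h : ℝ → ℝ) (i : Fin 6) : Plane → Plane :=
  shearMap (cellIso i) lam (cellX i) (cellSign i * mu) (cellBase i) h

theorem branch_eqOn (lam mu : ℝ) (h : ℝ → ℝ) (i : Fin 6) :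
    EqOn (branch lam mu h i) (foldingMap lam mu h).toFun (gridCell i) := by
  rintro z ⟨⟨a1, a2⟩, a3, a4⟩
  fin_cases i <;> simp [cellX, cellY] at a1 a2 a3 a4
  · simp [branch, shearMap, foldingMap, foldFun, cellIso, cellX, cellSign, cellBase, a2, a4]
  · simp [branch, shearMap, foldingMap, foldFun, cellIso, cellX, cellSign, cellBase, a2, a4, a3.not_gt]
  · have : ¬ z 1 < 0 := by linarith
    simp [branch, shearMap, foldingMap, foldFun, cellIso, cellX, cellSign, cellBase, a2, a3.not_gt,
      this]
  · have : ¬ z 0 < 1 := by linarith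
    simp [branch, shearMap, foldingMap, foldFun, cellIso, cellX, cellSign, cellBase,
      a4, swapPlane_apply, this]
  · have : ¬ z 0 < 1 := by linarith
    simp [branch, shearMap, foldingMap, foldFun, cellIso, cellX, cellSign, cellBase,
      a4, a3.not_gt, swapPlane_apply, this]
  · have : ¬ z 0 < 1 := by linarith
    have : ¬ z 1 < 0 := by linarith
    simp [branch, shearMap, foldingMap, foldFun, cellIso, cellX, cellSign, cellBase,
      a3.not_gt, swapPlane_apply, *]

theorem mem_dom_iff {lam mu : ℝ} {h : ℝ → ℝ} {z : Plane} :
    z ∈ (foldingMap lam mu h).dom ambientRect ↔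
      z ∈ ambientRect ∧ z 0 ≠ 1 ∧ z 1 ≠ 0 ∧ z 1 ≠ 1 := by
  change z ∈ ambientRect ∧ z ∉ _ ↔ _
  constructor
  · rintro ⟨h1, h2⟩
    have := mt (mem_iUnion_gridEdge h1).2 h2
    push Not at this
    exact ⟨h1, this⟩
  · rintro ⟨h1, h2⟩
    refine ⟨h1, fun h3 => ?_⟩
    have := (mem_iUnion_gridEdge h1).1 h3
    tauto

theorem dom_foldingMap (lam mu : ℝ) (h : ℝ → ℝ) :
    (foldingMap lam mu h).dom ambientRect = ⋃ i, gridCell i := by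
  ext z
  rw [mem_dom_iff, mem_iUnion_gridCell]

theorem abs_cellSign (i : Fin 6) : |cellSign i| = 1 := by
  fin_cases i <;> simp [cellSign]

/-- The formula of a branch makes sense on the whole plane, so one ball containing the closed cells
serves all cells and parameters. A bounded neighbourhood is chosen because branches with different
`mu` are not uniformly close on the plane. -/
theorem branch_isExpandingExtension {r : ℕ} (hr : 1 ≤ r) {lam mu : ℝ} {h : ℝ → ℝ} (hlam : 1 < lam)
    (hmu : lam ≤ mu) (hh : ContDiff ℝ r h) (hd : ∀ x, |deriv h x| ≤ (lam - 1) / 2) (i : Fin 6) :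
    IsExpandingExtension r ((lam + 1) / 2) (foldingMap lam mu h).toFun (gridCell i)
      (Metric.ball 0 10) (branch lam mu h i) where
  isOpen := Metric.isOpen_ball
  closure_subset := closure_gridCell_subset i
  eqOn := branch_eqOn lam mu h i
  contDiffOn := (shearMap_contDiff _ _ _ _ _ hh).contDiffOn
  injOn := by
    refine (shearMap_injective _ _ _ _ (by linarith) ?_).injOn
    have h1 := abs_cellSign i
    have : cellSign i ≠ 0 := fun h => by simp [h] at h1
    exact mul_ne_zero this (by linarith)
  expanding z _ v := by
    have h1 : HasDerivAt h (deriv h (z 0)) (z 0) :=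
      ((hh.differentiable (by exact_mod_cast (by omega : r ≠ 0))) (z 0)).hasDerivAt
    unfold branch
    rw [(shearMap_hasFDerivAt (cellIso i) lam (cellX i) (cellSign i * mu) (cellBase i) h1).fderiv]
    change _ ≤ ‖cellIso i (shearLin _ _ _ v)‖
    rw [LinearIsometryEquiv.norm_map]
    refine shearLin_expanding hlam ?_ (hd _) v
    rw [abs_mul, abs_cellSign, one_mul]
    exact hmu.trans (le_abs_self _)

theorem foldFun_mem {mu y : ℝ} (hmu : 0 < mu) (h1 : -1 < y) (h2 : y < 2) (h3 : y ≠ 0)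
    (h4 : y ≠ 1) : foldFun mu y ∈ Ioo 0 mu := by
  unfold foldFun
  split_ifs with a b
  · exact ⟨by nlinarith, by nlinarith⟩
  · exact ⟨mul_pos hmu (lt_of_le_of_ne (not_lt.1 a) h3.symm), by nlinarith⟩
  · have : 1 < y := lt_of_le_of_ne (not_lt.1 b) h4.symm
    exact ⟨mul_pos hmu (by linarith), by nlinarith⟩

/-- On the left the folded coordinate becomes the ordinate, and the strip -1 < y < 0 leaves room for
negative values of `h`. On the right it becomes the abscissa, which must be positive; hence the sign
condition on `h` for x > 1. -/
theorem foldingMap_mapsTo {lam mu : ℝ} {h : ℝ → ℝ} (hlam : 1 < lam) (hlm : lam ≤ mu)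
    (hmu : mu ≤ 3 / 2) (hb : ∀ x, |h x| ≤ 1 / 2) (hpos : ∀ x > 1, 0 ≤ h x) :
    MapsTo (foldingMap lam mu h).toFun ((foldingMap lam mu h).dom ambientRect) ambientRect := by
  intro z hz
  obtain ⟨⟨⟨h1, h2⟩, h3, h4⟩, h5, h6, h7⟩ := mem_dom_iff.1 hz
  obtain ⟨f1, f2⟩ := foldFun_mem (by linarith : 0 < mu) h3 h4 h6 h7
  obtain ⟨b1, b2⟩ := abs_le.1 (hb (z 0))
  by_cases h8 : z 0 < 1
  · have : (foldingMap lam mu h).toFun z = !₂[lam * z 0, foldFun mu (z 1) + h (z 0)] := if_pos h8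
    rw [this]
    refine ⟨⟨?_, ?_⟩, ?_, ?_⟩ <;> simp <;> nlinarith
  · have : (foldingMap lam mu h).toFun z = !₂[foldFun mu (z 1) + h (z 0), lam * (z 0 - 1)] :=
      if_neg h8
    rw [this]
    have h9 : 1 < z 0 := lt_of_le_of_ne (not_lt.1 h8) h5.symm
    have := hpos _ h9
    refine ⟨⟨?_, ?_⟩, ?_, ?_⟩ <;> simp <;> nlinarith

theorem foldingMap_isPiecewiseExpanding {r : ℕ} (hr : 1 ≤ r) {lam mu : ℝ} {h : ℝ → ℝ}
    (hlam : 1 < lam) (hlm : lam ≤ mu) (hmu : mu ≤ 3 / 2) (hh : ContDiff ℝ r h)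
    (hd : ∀ x, |deriv h x| ≤ (lam - 1) / 2) (hb : ∀ x, |h x| ≤ 1 / 2) (hpos : ∀ x > 1, 0 ≤ h x) :
    IsPiecewiseExpanding r ambientRect (foldingMap lam mu h) where
  curve_regular := gridEdge_isSimpleRegularCurve r
  curve_subset := gridEdge_image_subset
  curve_disjoint _ _ := gridEdge_disjoint
  vertex_degree := gridEdge_vertex
  piece_injective i j hij := by
    obtain ⟨z, hz⟩ := gridCell_nonempty i
    exact gridCell_unique i j z hz (hij ▸ hz : z ∈ (foldingMap lam mu h).piece j)
  piece_range := components_eq_range (dom_foldingMap lam mu h) (fun i => isOpen_openRect _ _ _ _)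
    (fun i => (convex_openRect _ _ _ _).isPreconnected) gridCell_nonempty gridCell_unique
  mapsTo := foldingMap_mapsTo hlam hlm hmu hb hpos
  extension := ⟨(lam + 1) / 2, by linarith, fun i =>
    ⟨_, _, branch_isExpandingExtension hr hlam hlm hh hd i⟩⟩

/-! ### Convergence of the branches -/

/-- The stretched coordinates of the two branches cancel. What is left is a scalar function on one
axis: a multiple of an affine function of y, plus `h` composed with the first projection, and both
the projection and the embedding of the axis have norm at most 1. -/
theorem norm_iteratedFDeriv_branch_sub_le {r : ℕ} {lam mu mu' : ℝ} {h : ℝ → ℝ}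
    (hh : ContDiff ℝ r h) {ε : ℝ} (hε : ∀ k ≤ r, ∀ x, ‖iteratedFDeriv ℝ k h x‖ ≤ ε) (i : Fin 6)
    {k : ℕ} (hk : k ≤ r) (z : Plane) :
    ‖iteratedFDeriv ℝ k (branch lam mu h i) z - iteratedFDeriv ℝ k (branch lam mu' 0 i) z‖ ≤
      |mu - mu'| * ‖iteratedFDeriv ℝ k (fun z : Plane => z 1 - cellBase i) z‖ + ε := by
  have hk' : (k : WithTop ℕ∞) ≤ r := by exact_mod_cast hk
  set ψ : Plane → ℝ := fun z => z 1 - cellBase i 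
  set p0 : Plane →L[ℝ] ℝ := EuclideanSpace.proj (𝕜 := ℝ) (0 : Fin 2)
  set u : Plane := cellIso i (EuclideanSpace.single (1 : Fin 2) (1 : ℝ))
  have hu : ‖u‖ = 1 := by simp [u]
  set L : ℝ →L[ℝ] Plane := (ContinuousLinearMap.id ℝ ℝ).smulRight u with hL
  have hLn : ‖L‖ ≤ 1 := by
    refine ContinuousLinearMap.opNorm_le_bound _ zero_le_one fun x => ?_
    simp [hL, norm_smul, hu]
  have hψ : ContDiff ℝ k ψ :=
    (EuclideanSpace.proj (𝕜 := ℝ) (1 : Fin 2) : Plane →L[ℝ] ℝ).contDiff.sub contDiff_const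
  have hhk : ContDiff ℝ k h := hh.of_le hk'
  have hhp : ContDiff ℝ k (h ∘ p0) := hhk.comp p0.contDiff
  have e1 : branch lam mu h i - branch lam mu' 0 i
      = L ∘ ((cellSign i * (mu - mu')) • ψ + h ∘ p0) := by
    funext z
    simp only [branch, shearMap, Pi.sub_apply, ← map_sub, Function.comp_apply, hL,
      ContinuousLinearMap.smulRight_apply, ContinuousLinearMap.id_apply, u, ← map_smul]
    congr 1
    ext j
    fin_cases j
    · simp
    · simp [ψ, p0]
      ring
  have hc : ContDiff ℝ k ((cellSign i * (mu - mu')) • ψ) :=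
    show ContDiff ℝ k fun y => (cellSign i * (mu - mu')) • ψ y from hψ.const_smul _
  have e2 : iteratedFDeriv ℝ k (branch lam mu h i) z - iteratedFDeriv ℝ k (branch lam mu' 0 i) z
      = iteratedFDeriv ℝ k (branch lam mu h i - branch lam mu' 0 i) z := by
    have b1 : ContDiff ℝ k (branch lam mu h i) := shearMap_contDiff _ _ _ _ _ hhk
    have h0 : ContDiff ℝ k (0 : ℝ → ℝ) := contDiff_const
    have b2 : ContDiff ℝ k (branch lam mu' 0 i) := shearMap_contDiff _ _ _ _ _ h0
    rw [iteratedFDeriv_sub b1 b2]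
    rfl
  rw [e2, e1]
  refine (L.norm_iteratedFDeriv_comp_left (hc.add hhp).contDiffAt (le_refl _)).trans ?_
  refine (mul_le_of_le_one_left (norm_nonneg _) hLn).trans ?_
  change ‖iteratedFDeriv ℝ k ((cellSign i * (mu - mu')) • ψ + h ∘ p0) z‖ ≤ _
  rw [iteratedFDeriv_add hc hhp, Pi.add_apply]
  refine (norm_add_le _ _).trans (add_le_add ?_ ?_)
  · rw [iteratedFDeriv_const_smul_apply hψ.contDiffAt, norm_smul, Real.norm_eq_abs, abs_mul,
      abs_cellSign, one_mul]
  · rw [p0.iteratedFDeriv_comp_right hhk z le_rfl]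
    refine (ContinuousMultilinearMap.norm_compContinuousLinearMap_le _ _).trans ?_
    have hp0 : ‖p0‖ ≤ 1 := ContinuousLinearMap.opNorm_le_bound _ zero_le_one fun x => by
      rw [one_mul]; exact PiLp.norm_apply_le x 0
    refine (mul_le_of_le_one_right (norm_nonneg _) ?_).trans (hε k hk _)
    simp only [Finset.prod_const]
    exact pow_le_one₀ (norm_nonneg _) hp0

theorem foldingMap_crTendsto {r : ℕ} (hr : 1 ≤ r) {lam : ℝ} (hlam : 1 < lam) {mu : ℝ → ℝ}
    {h : ℝ → ℝ → ℝ} {ε : ℝ → ℝ} {l : Filter ℝ} (hlm : ∀ᶠ σ in l, lam ≤ mu σ)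
    (hmu : Tendsto mu l (𝓝 lam)) (hε : Tendsto ε l (𝓝 0)) (hh : ∀ᶠ σ in l, ContDiff ℝ r (h σ))
    (hd : ∀ᶠ σ in l, ∀ x, |deriv (h σ) x| ≤ (lam - 1) / 2)
    (hb : ∀ᶠ σ in l, ∀ k ≤ r, ∀ x, ‖iteratedFDeriv ℝ k (h σ) x‖ ≤ ε σ) :
    CrTendsto r (fun σ => foldingMap lam (mu σ) (h σ)) l (foldingMap lam lam 0) where
  curve j k _ := by
    rw [Metric.tendstoUniformlyOn_iff]
    intro ε hε
    exact Eventually.of_forall fun σ x _ => by simpa [foldingMap] using hε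
  piece i := by
    have : ∀ σ, Metric.hausdorffDist (closure ((foldingMap lam (mu σ) (h σ)).piece i))
        (closure ((foldingMap lam lam 0).piece i)) = 0 := fun σ =>
      Metric.hausdorffDist_self_zero
    simp only [this]
    exact tendsto_const_nhds
  map i := by
    refine ⟨(lam + 1) / 2, Metric.ball 0 10, fun σ => branch lam (mu σ) (h σ) i,
      branch lam lam 0 i, by linarith, ?_, ?_, ?_⟩
    · have h0 : ContDiff ℝ r (0 : ℝ → ℝ) := contDiff_const
      refine branch_isExpandingExtension hr hlam le_rfl h0 (fun x => ?_) i
      have : deriv (0 : ℝ → ℝ) x = 0 := deriv_const x (0 : ℝ)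
      rw [this, abs_zero]
      linarith
    · filter_upwards [hlm, hh, hd] with σ h1 h2 h3
      exact branch_isExpandingExtension hr hlam h1 h2 h3 i
    · intro k hk
      have hψ : ContDiff ℝ k fun z : Plane => z 1 - cellBase i :=
        (EuclideanSpace.proj (𝕜 := ℝ) (1 : Fin 2) : Plane →L[ℝ] ℝ).contDiff.sub contDiff_const
      obtain ⟨M, hM⟩ := (isCompact_closedBall (0 : Plane) 10).exists_bound_of_continuousOn
        (hψ.continuous_iteratedFDeriv le_rfl).continuousOn
      rw [Metric.tendstoUniformlyOn_iff]
      intro δ hδ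
      have hlim : Tendsto (fun σ => |mu σ - lam| * M + ε σ) l (𝓝 0) := by
        have := (((hmu.sub_const lam).abs).mul_const M).add hε
        simpa using this
      filter_upwards [hh, hb, hlim.eventually (gt_mem_nhds hδ)] with σ h1 h2 h3 z hz
      rw [dist_comm, dist_eq_norm]
      refine lt_of_le_of_lt ((norm_iteratedFDeriv_branch_sub_le h1 h2 i hk z).trans ?_) h3
      gcongr
      exact hM z (Metric.ball_subset_closedBall hz)

/-! ### Averages of sequences growing at two rates -/

/-- A sequence growing like `ℓ n + D g n` has divergent averages if `g n / n` oscillates. -/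
theorem not_tendsto_average {L g : ℕ → ℝ} {l D C : ℝ} (hD : 0 < D)
    (hL : ∀ n : ℕ, |L n - l * n - D * g n| ≤ C) (hhi : ∃ᶠ n : ℕ in atTop, 3 * (n : ℝ) ≤ 4 * g n)
    (hlo : ∃ᶠ n : ℕ in atTop, 2 * g n ≤ (n : ℝ)) :
    ¬ ∃ c, Tendsto (fun n : ℕ => 1 / (n : ℝ) * L n) atTop (𝓝 c) := by
  rintro ⟨c, hc⟩
  have h1 : Tendsto (fun n : ℕ => (L n - l * n - D * g n) / (n : ℝ)) atTop (𝓝 0) := by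
    have h2 : Tendsto (fun n : ℕ => C / (n : ℝ)) atTop (𝓝 0) :=
      tendsto_const_div_atTop_nhds_zero_nat C
    refine squeeze_zero_norm (fun n => ?_) h2
    rw [norm_div, Real.norm_eq_abs, Real.norm_natCast]
    gcongr
    exact hL n
  -- Convergence of the averages would force `g n / n` to converge, to a limit both at least 3/4 and
  -- at most 1/2.
  have h2 : Tendsto (fun n : ℕ => g n / (n : ℝ)) atTop (𝓝 (((c - l) - 0) / D)) := by
    refine (((hc.sub_const l).sub h1).div_const D).congr' ?_
    filter_upwards [eventually_gt_atTop 0] with n hn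
    have : (n : ℝ) ≠ 0 := by positivity
    field_simp
    ring
  have h3 : (3 : ℝ) / 4 ≤ ((c - l) - 0) / D := by
    refine ge_of_tendsto_of_frequently h2 ?_
    refine (hhi.and_eventually (eventually_gt_atTop 0)).mono fun n hn => ?_
    have : (0 : ℝ) < n := by exact_mod_cast hn.2
    rw [div_le_div_iff₀ (by norm_num) this]
    linarith [hn.1]
  have h4 : ((c - l) - 0) / D ≤ 1 / 2 := by
    refine le_of_tendsto_of_frequently h2 ?_
    refine (hlo.and_eventually (eventually_gt_atTop 0)).mono fun n hn => ?_
    have : (0 : ℝ) < n := by exact_mod_cast hn.2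
    rw [div_le_div_iff₀ this (by norm_num)]
    linarith [hn.1]
  linarith

/-- A discrete intermediate value argument: at the first index after a high one where the count is
at most half, the preceding count exceeded half, and counts never decrease, so equality holds. -/
theorem frequently_two_mul_count_eq (s : ℕ → Prop) [DecidablePred s]
    (hhi : ∃ᶠ n in atTop, 3 * n ≤ 4 * Nat.count s n)
    (hlo : ∃ᶠ n in atTop, 4 * Nat.count s n ≤ n) :
    ∃ᶠ n in atTop, 2 * Nat.count s n = n := by
  rw [frequently_atTop]
  intro N
  obtain ⟨n₁, hn₁, h₁⟩ := frequently_atTop.1 hhi N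
  have hex : ∃ n, n₁ ≤ n ∧ 2 * Nat.count s n ≤ n := by
    obtain ⟨n₂, hn₂, h₂⟩ := frequently_atTop.1 hlo n₁
    exact ⟨n₂, hn₂, by omega⟩
  set n := Nat.find hex with hn
  obtain ⟨h2, h3⟩ := Nat.find_spec hex
  refine ⟨n, hn₁.trans h2, ?_⟩
  rcases eq_or_lt_of_le h2 with h | h
  · have h4 : n = n₁ := h.symm
    rw [← hn] at h3
    rw [h4] at h3 ⊢
    omega
  · obtain ⟨j, hj⟩ : ∃ j, n = j + 1 := ⟨n - 1, by omega⟩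
    have h4 := Nat.find_min hex (m := j) (by omega)
    push Not at h4
    have h5 := h4 (by omega)
    have h6 : Nat.count s j ≤ Nat.count s n := Nat.count_monotone s (by omega)
    have h7 : 2 * Nat.count s n ≤ n := h3
    omega

section growth

variable {lam mu : ℝ} {x y : ℝ} {p q : ℕ → ℕ} {w : ℕ → ℝ}

/-- The exponents sum to `n`, so both stretching factors lie between `lam ^ n` and `mu ^ n`. -/
theorem growth_bounds (hlam : 1 < lam) (hmu : lam < mu) (hpq : ∀ n, p n + q n = n)
    (hw0 : ∀ n, 0 ≤ w n)
    (hw : ∀ n, w n ^ 2 = (lam ^ p n * mu ^ q n * x) ^ 2 + (lam ^ q n * mu ^ p n * y) ^ 2)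
    (n : ℕ) : lam ^ n * √(x ^ 2 + y ^ 2) ≤ w n ∧ w n ≤ mu ^ n * √(x ^ 2 + y ^ 2) := by
  have l0 : 0 < lam := by linarith
  have m0 : 0 < mu := by linarith
  have hs : √(x ^ 2 + y ^ 2) ^ 2 = x ^ 2 + y ^ 2 := Real.sq_sqrt (by positivity)
  have key : ∀ a b : ℕ, a + b = n → lam ^ n ≤ lam ^ a * mu ^ b ∧ lam ^ a * mu ^ b ≤ mu ^ n := by
    rintro a b rfl
    rw [pow_add, pow_add]
    constructor <;> gcongr
  obtain ⟨k1, k2⟩ := key (p n) (q n) (hpq n)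
  obtain ⟨k3, k4⟩ := key (q n) (p n) (by rw [add_comm]; exact hpq n)
  constructor
  · apply le_of_sq_le_sq _ (hw0 n)
    rw [mul_pow, hs, hw, mul_pow, mul_pow _ y, mul_add]
    gcongr
  · apply le_of_sq_le_sq _ (by positivity)
    rw [mul_pow, hs, hw, mul_pow, mul_pow _ y, mul_add]
    gcongr

/-- The averaged logarithm of a sequence which grows at two rates, switching between them in long
blocks, has a nontrivial interval as its limit set. -/
theorem omegaLimitSeq_growth {s : ℕ → Prop} [DecidablePred s] (hlam : 1 < lam) (hmu : lam < mu)
    (hpq : ∀ n, p n + q n = n) (hq : ∀ n, q n = Nat.count s n) (hw0 : ∀ n, 0 ≤ w n)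
    (hw : ∀ n, w n ^ 2 = (lam ^ p n * mu ^ q n * x) ^ 2 + (lam ^ q n * mu ^ p n * y) ^ 2)
    (hxy : x ≠ 0 ∨ y ≠ 0)
    (hhi : ∃ᶠ n in atTop, 3 * n ≤ 4 * Nat.count s n)
    (hlo : ∃ᶠ n in atTop, 4 * Nat.count s n ≤ n) :
    (∃ a b : ℝ, a < b ∧ omegaLimitSeq (fun n : ℕ => 1 / (n : ℝ) * Real.log (w n)) = Icc a b) ∧
      omegaLimitSeq (fun n : ℕ => 1 / (n : ℝ) * Real.log (w n)) ⊆
        Icc (Real.log lam) (Real.log mu) := by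
  have l0 : 0 < lam := by linarith
  have m0 : 0 < mu := by linarith
  have hl0 : 0 < Real.log lam := Real.log_pos hlam
  have hlm : Real.log lam < Real.log mu := Real.log_lt_log l0 hmu
  set c := √(x ^ 2 + y ^ 2) with hc
  have hc0 : 0 < c := Real.sqrt_pos.2 (by
    rcases hxy with h | h
    · have := sq_pos_of_ne_zero h; positivity
    · have := sq_pos_of_ne_zero h; positivity)
  have hb := growth_bounds hlam hmu hpq hw0 hw
  have hwpos : ∀ n, 0 < w n := fun n => lt_of_lt_of_le (by positivity) (hb n).1
  set L : ℕ → ℝ := fun n => Real.log (w n) with hL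
  set κ := Real.log c with hκ
  have hLlo : ∀ n : ℕ, Real.log lam * n + κ ≤ L n := by
    intro n
    have := Real.log_le_log (by positivity) (hb n).1
    rw [Real.log_mul (by positivity) (by positivity), Real.log_pow] at this
    linarith
  have hLhi : ∀ n : ℕ, L n ≤ Real.log mu * n + κ := by
    intro n
    have := Real.log_le_log (hwpos n) (hb n).2
    rw [Real.log_mul (by positivity) (by positivity), Real.log_pow] at this
    linarith
  set a : ℕ → ℝ := fun n => 1 / (n : ℝ) * L n with ha
  have halo : ∀ n : ℕ, 0 < n → Real.log lam + κ / n ≤ a n := by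
    intro n hn
    have hn' : (0 : ℝ) < n := by exact_mod_cast hn
    have : Real.log lam + κ / n = 1 / (n : ℝ) * (Real.log lam * n + κ) := by field_simp
    rw [this]
    exact mul_le_mul_of_nonneg_left (hLlo n) (by positivity)
  have hahi : ∀ n : ℕ, 0 < n → a n ≤ Real.log mu + κ / n := by
    intro n hn
    have hn' : (0 : ℝ) < n := by exact_mod_cast hn
    have : Real.log mu + κ / n = 1 / (n : ℝ) * (Real.log mu * n + κ) := by field_simp
    rw [this]
    exact mul_le_mul_of_nonneg_left (hLhi n) (by positivity)
  have hκn : Tendsto (fun n : ℕ => κ / (n : ℝ)) atTop (𝓝 0) :=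
    tendsto_const_div_atTop_nhds_zero_nat κ
  have hA : ∀ ε > 0, ∀ᶠ n in atTop, Real.log lam - ε ≤ a n := by
    intro ε hε
    filter_upwards [hκn.eventually (lt_mem_nhds (show -ε < 0 by linarith)),
      eventually_gt_atTop 0] with n h1 h2
    linarith [halo n h2]
  have hB : ∀ ε > 0, ∀ᶠ n in atTop, a n ≤ Real.log mu + ε := by
    intro ε hε
    filter_upwards [hκn.eventually (gt_mem_nhds hε), eventually_gt_atTop 0] with n h1 h2
    linarith [hahi n h2]
  refine ⟨?_, omegaLimitSeq_subset_Icc hA hB⟩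
  -- In one step each of the two stretching factors grows by `lam` or `mu`, hence the norm by a
  -- factor in `[1, mu]`.
  have hstep : ∀ n, |L (n + 1) - L n| ≤ Real.log mu := by
    intro n
    have key : ∀ a b a' b' : ℕ, (a' = a + 1 ∧ b' = b ∨ a' = a ∧ b' = b + 1) →
        lam ^ a * mu ^ b ≤ lam ^ a' * mu ^ b' ∧ lam ^ a' * mu ^ b' ≤ mu * (lam ^ a * mu ^ b) := by
      have h1m : 1 ≤ mu := by linarith
      intro i j i' j' h
      have : 0 < lam ^ i * mu ^ j := by positivity
      rcases h with ⟨h1, h2⟩ | ⟨h1, h2⟩ <;> rw [h1, h2, pow_succ] <;> constructor <;> nlinarith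
    have hpq1 : p (n + 1) = p n + 1 ∧ q (n + 1) = q n ∨ p (n + 1) = p n ∧ q (n + 1) = q n + 1 := by
      have h1 := hpq n
      have h2 := hpq (n + 1)
      have h3 := hq n
      have h4 := hq (n + 1)
      rw [Nat.count_succ] at h4
      split_ifs at h4 <;> omega
    obtain ⟨k1, k2⟩ := key _ _ _ _ hpq1
    obtain ⟨k3, k4⟩ := key (q n) (p n) (q (n + 1)) (p (n + 1)) (by tauto)
    have h1 : w n ≤ w (n + 1) := by
      apply le_of_sq_le_sq _ (hw0 _)
      rw [hw, hw, mul_pow, mul_pow _ y, mul_pow _ x, mul_pow _ y]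
      gcongr
    have h2 : w (n + 1) ≤ mu * w n := by
      apply le_of_sq_le_sq _ (mul_nonneg m0.le (hw0 n))
      have h2 : (mu * w n) ^ 2 = (mu * (lam ^ p n * mu ^ q n)) ^ 2 * x ^ 2
          + (mu * (lam ^ q n * mu ^ p n)) ^ 2 * y ^ 2 := by
        rw [mul_pow, hw]
        ring
      rw [h2, hw, mul_pow _ x, mul_pow _ y]
      gcongr
    have h3 := Real.log_le_log (hwpos n) h1
    have h4 := Real.log_le_log (hwpos _) h2
    rw [Real.log_mul m0.ne' (hwpos n).ne'] at h4
    rw [abs_le]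
    constructor <;> simp only [hL] <;> linarith
  have hd : Tendsto (fun n => a (n + 1) - a n) atTop (𝓝 0) := by
    have h0 : Tendsto (fun n : ℕ => (2 * Real.log mu + |κ|) / ((n : ℝ) + 1)) atTop (𝓝 0) :=
      (tendsto_const_div_atTop_nhds_zero_nat (2 * Real.log mu + |κ|)).comp (tendsto_add_atTop_nat 1)
        |>.congr fun n => by simp
    refine squeeze_zero_norm' ?_ h0
    filter_upwards [eventually_gt_atTop 0] with n hn
    have hn' : (1 : ℝ) ≤ n := by exact_mod_cast hn
    have h1 : a (n + 1) - a n = ((L (n + 1) - L n) - a n) / ((n : ℝ) + 1) := by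
      simp only [ha]
      push_cast
      field_simp
      ring
    have h2 : |κ / n| ≤ |κ| := by
      rw [abs_div, Nat.abs_cast]
      exact div_le_self (abs_nonneg _) hn'
    obtain ⟨h3, h4⟩ := abs_le.1 h2
    have h5 : |a n| ≤ Real.log mu + |κ| := by
      rw [abs_le]
      constructor <;> linarith [halo n hn, hahi n hn, abs_nonneg κ]
    rw [h1, norm_div, Real.norm_eq_abs, Real.norm_eq_abs, abs_of_pos (by linarith : (0 : ℝ) < n + 1)]
    gcongr
    exact (abs_sub _ _).trans (by linarith [hstep n])
  refine omegaLimitSeq_eq_Icc (hA 1 one_pos) (hB 1 one_pos) hd ?_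
  have hqlog : ∀ n, Real.log (lam ^ p n * mu ^ q n)
      = Real.log lam * n + (Real.log mu - Real.log lam) * q n := by
    intro n
    rw [Real.log_mul (by positivity) (by positivity), Real.log_pow, Real.log_pow]
    have : (n : ℝ) = p n + q n := by exact_mod_cast (hpq n).symm
    rw [this]
    ring
  have hplog : ∀ n, Real.log (lam ^ q n * mu ^ p n)
      = Real.log lam * n + (Real.log mu - Real.log lam) * p n := by
    intro n
    rw [Real.log_mul (by positivity) (by positivity), Real.log_pow, Real.log_pow]
    have : (n : ℝ) = p n + q n := by exact_mod_cast (hpq n).symm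
    rw [this]
    ring
  have hhi' : ∃ᶠ n : ℕ in atTop, 3 * (n : ℝ) ≤ 4 * (q n : ℝ) :=
    hhi.mono fun n hn => by rw [hq]; exact_mod_cast hn
  have hlo' : ∃ᶠ n : ℕ in atTop, 4 * (q n : ℝ) ≤ (n : ℝ) :=
    hlo.mono fun n hn => by rw [hq]; exact_mod_cast hn
  have hpq' : ∀ n, (p n : ℝ) + q n = n := fun n => by exact_mod_cast hpq n
  -- For a vector on a coordinate axis a single count governs the growth, up to a constant: `q` for
  -- the first axis, `p` for the second.
  by_cases hy : y = 0
  · have hx : x ≠ 0 := by tauto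
    have h1 : ∀ n, w n = lam ^ p n * mu ^ q n * |x| := by
      intro n
      have := hw n
      rw [hy, mul_zero, zero_pow two_ne_zero, add_zero, ← sq_abs (_ * x), abs_mul,
        abs_of_pos (show 0 < lam ^ p n * mu ^ q n by positivity)] at this
      exact (pow_left_inj₀ (hw0 n) (by positivity) two_ne_zero).1 this
    refine not_tendsto_average (l := Real.log lam) (g := fun n => q n) (C := |Real.log (|x|)|) (sub_pos.2 hlm)
      (fun n => ?_) hhi' (hlo'.mono fun n hn => ?_)
    · simp only [hL]
      rw [h1, Real.log_mul (by positivity) (by positivity), hqlog]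
      apply le_of_eq
      congr 1
      ring
    · have : (0 : ℝ) ≤ q n := by positivity
      linarith
  by_cases hx : x = 0
  · have h1 : ∀ n, w n = lam ^ q n * mu ^ p n * |y| := by
      intro n
      have := hw n
      rw [hx, mul_zero, zero_pow two_ne_zero, zero_add, ← sq_abs (_ * y), abs_mul,
        abs_of_pos (show 0 < lam ^ q n * mu ^ p n by positivity)] at this
      exact (pow_left_inj₀ (hw0 n) (by positivity) two_ne_zero).1 this
    refine not_tendsto_average (l := Real.log lam) (g := fun n => p n) (C := |Real.log (|y|)|) (sub_pos.2 hlm)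
      (fun n => ?_) (hlo'.mono fun n hn => ?_) (hhi'.mono fun n hn => ?_)
    · simp only [hL]
      rw [h1, Real.log_mul (by positivity) (by positivity), hplog]
      apply le_of_eq
      congr 1
      ring
    · linarith [hpq' n]
    · have : (0 : ℝ) ≤ n := by positivity
      linarith [hpq' n]
  have hδ : ∃ δ, 0 < δ ∧ δ ≤ |x| ∧ δ ≤ |y| :=
    ⟨min |x| |y|, lt_min (by positivity) (by positivity), min_le_left _ _, min_le_right _ _⟩
  obtain ⟨δ, hδ0, hδx, hδy⟩ := hδ
  -- With both components nonzero the norm is comparable to the larger stretching factor, with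
  -- constants `δ` and `c`, so the larger count governs.
  refine not_tendsto_average (l := Real.log lam) (g := fun n => max (p n : ℝ) (q n)) (C := |Real.log δ| + |κ|)
    (sub_pos.2 hlm) (fun n => ?_) (hhi'.mono fun n hn => ?_) ?_
  · set X := lam ^ p n * mu ^ q n with hX
    set Y := lam ^ q n * mu ^ p n with hY
    have hX0 : 0 < X := by positivity
    have hY0 : 0 < Y := by positivity
    have hmax : Real.log (max X Y)
        = Real.log lam * n + (Real.log mu - Real.log lam) * max (p n : ℝ) (q n) := by
      have hD := (sub_pos.2 hlm).le
      rw [mul_max_of_nonneg _ _ hD, ← max_add_add_left, ← hqlog, ← hplog]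
      rcases le_total X Y with h | h
      · rw [max_eq_right h, max_eq_left (Real.log_le_log hX0 h)]
      · rw [max_eq_left h, max_eq_right (Real.log_le_log hY0 h)]
    have hM0 : 0 < max X Y := lt_max_of_lt_left hX0
    have h1 : δ * max X Y ≤ w n := by
      apply le_of_sq_le_sq _ (hw0 n)
      rw [hw]
      rcases le_total X Y with h | h
      · rw [max_eq_right h]
        have : (δ * Y) ^ 2 ≤ (Y * y) ^ 2 := by
          rw [← sq_abs (Y * y), abs_mul, abs_of_pos hY0, mul_comm]
          gcongr
        linarith [sq_nonneg (X * x)]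
      · rw [max_eq_left h]
        have : (δ * X) ^ 2 ≤ (X * x) ^ 2 := by
          rw [← sq_abs (X * x), abs_mul, abs_of_pos hX0, mul_comm]
          gcongr
        linarith [sq_nonneg (Y * y)]
    have h2 : w n ≤ c * max X Y := by
      apply le_of_sq_le_sq _ (by positivity)
      have h2 : (c * max X Y) ^ 2 = max X Y ^ 2 * x ^ 2 + max X Y ^ 2 * y ^ 2 := by
        rw [mul_pow, Real.sq_sqrt (by positivity)]
        ring
      rw [hw, h2, mul_pow _ x, mul_pow _ y]
      gcongr
      · exact le_max_left _ _
      · exact le_max_right _ _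
    have h3 := Real.log_le_log (by positivity) h1
    have h4 := Real.log_le_log (hwpos n) h2
    rw [Real.log_mul hδ0.ne' hM0.ne', hmax] at h3
    rw [Real.log_mul hc0.ne' hM0.ne', hmax] at h4
    have h5 := neg_abs_le (Real.log δ)
    have h6 := le_abs_self κ
    rw [abs_le]
    constructor <;> simp only [hL] <;> linarith [abs_nonneg (Real.log δ), abs_nonneg κ]
  · linarith [le_max_right (p n : ℝ) (q n)]
  -- The larger count is never below `n / 2`, so the low values come from the times when the two
  -- counts agree.
  · refine (frequently_two_mul_count_eq s hhi hlo).mono fun n hn => ?_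
    rw [← hq] at hn
    have h1 : (2 : ℝ) * q n = n := by exact_mod_cast hn
    have h2 : (p n : ℝ) = q n := by linarith [hpq' n]
    rw [h2, max_self]
    linarith

end growth

/-! ### Orbits of rectangles: null sets and derivatives -/

theorem volume_coord_eq (i : Fin 2) (c : ℝ) : volume {z : Plane | z i = c} = 0 := by
  have h1 := (PiLp.volume_preserving_ofLp (Fin 2)).measure_preimage
    (s := {f : Fin 2 → ℝ | f i = c})
    (measurableSet_eq_fun (measurable_pi_apply i) measurable_const).nullMeasurableSet
  have h2 : volume {f : Fin 2 → ℝ | f i = c} = 0 := by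
    rw [volume_pi]
    exact Measure.pi_hyperplane (fun _ : Fin 2 => (volume : Measure ℝ)) i c
  rw [h2] at h1
  exact h1

theorem volume_ambientRect_diff_dom (lam mu : ℝ) (h : ℝ → ℝ) :
    volume (ambientRect \ (foldingMap lam mu h).dom ambientRect) = 0 := by
  refine measure_mono_null (t := {z : Plane | z 0 = 1} ∪ ({z | z 1 = 0} ∪ {z | z 1 = 1})) ?_ ?_
  · rintro z ⟨hz, hz'⟩
    rw [mem_dom_iff] at hz'
    by_contra hcon
    simp only [mem_union, mem_ofPred_eq, not_or] at hcon
    exact hz' ⟨hz, hcon⟩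
  · exact measure_union_null (volume_coord_eq 0 1)
      (measure_union_null (volume_coord_eq 1 0) (volume_coord_eq 1 1))

theorem volume_preimage_shearMap_const (ι : Plane ≃ₗᵢ[ℝ] Plane) {lam s : ℝ} (c d H : ℝ)
    (hlam : lam ≠ 0) (hs : s ≠ 0) {Z : Set Plane} (hZ : volume Z = 0) :
    volume (shearMap ι lam c s d (fun _ => H) ⁻¹' Z) = 0 := by
  set A : Plane →L[ℝ] Plane := (ι : Plane →L[ℝ] Plane).comp (shearLin lam s 0) with hA
  set b : Plane := shearMap ι lam c s d (fun _ => H) 0 with hb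
  have h1 : ∀ z, shearMap ι lam c s d (fun _ => H) z = A z + b := by
    intro z
    simp only [hb, hA, shearMap]
    change _ = ι (shearLin lam s 0 z) + _
    rw [← map_add, shearLin_apply]
    congr 1
    ext i
    fin_cases i <;> simp <;> ring
  have hdet : LinearMap.det (A : Plane →ₗ[ℝ] Plane) ≠ 0 := by
    intro h0
    have h2 := LinearMap.bot_lt_ker_of_det_eq_zero h0
    have h3 : Function.Injective (A : Plane →ₗ[ℝ] Plane) := by
      intro x y hxy
      apply shearMap_injective ι c d (fun _ => H) hlam hs
      rw [h1, h1]
      exact congrArg (· + b) hxy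
    rw [LinearMap.ker_eq_bot.2 h3] at h2
    exact lt_irrefl _ h2
  have h2 : shearMap ι lam c s d (fun _ => H) ⁻¹' Z = A ⁻¹' ((fun z => z + b) ⁻¹' Z) := by
    ext z
    simp [h1]
  rw [h2, Measure.addHaar_preimage_continuousLinearMap _ hdet, measure_preimage_add_right, hZ,
    mul_zero]

/-- Since `h` has derivative zero at the abscissa, the shear entry disappears. Absolute values
suffice, as the signs of the fold do not affect norms. -/
theorem foldingMap_hasFDerivAt {lam mu : ℝ} {h : ℝ → ℝ} (hlam : 0 < lam) (hmu : 0 < mu) {z : Plane}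
    (hz : z ∈ (foldingMap lam mu h).dom ambientRect) (hh : HasDerivAt h 0 (z 0)) :
    ∃ B : Plane →L[ℝ] Plane, HasFDerivAt (foldingMap lam mu h).toFun B z ∧
      ∀ v, (z 0 < 1 → |B v 0| = lam * |v 0| ∧ |B v 1| = mu * |v 1|) ∧
        (1 < z 0 → |B v 0| = mu * |v 1| ∧ |B v 1| = lam * |v 0|) := by
  rw [dom_foldingMap] at hz
  obtain ⟨i, hi⟩ := mem_iUnion.1 hz
  refine ⟨_, ((shearMap_hasFDerivAt (cellIso i) lam (cellX i) (cellSign i * mu) (cellBase i)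
    hh).congr_of_eventuallyEq ?_), fun v => ?_⟩
  · filter_upwards [(isOpen_openRect _ _ _ _ : IsOpen (gridCell i)).mem_nhds hi] with y hy
    exact (branch_eqOn lam mu h i hy).symm
  · change (z 0 < 1 → |cellIso i (shearLin _ _ _ v) 0| = _ ∧ |cellIso i (shearLin _ _ _ v) 1| = _) ∧
      (1 < z 0 → |cellIso i (shearLin _ _ _ v) 0| = _ ∧ |cellIso i (shearLin _ _ _ v) 1| = _)
    have hs : |cellSign i * mu * v 1| = mu * |v 1| := by
      rw [abs_mul, abs_mul, abs_cellSign, one_mul, abs_of_pos hmu]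
    have hl : |lam * v 0| = lam * |v 0| := by rw [abs_mul, abs_of_pos hlam]
    obtain ⟨⟨a1, a2⟩, -⟩ := hi
    rw [shearLin_apply]
    constructor
    · intro hz1
      have : i < 3 := by
        fin_cases i <;> simp [cellX] at a1 a2 ⊢ <;> linarith
      simp [cellIso, this, hs, hl]
    · intro hz1
      have : ¬ i < 3 := by
        fin_cases i <;> simp [cellX] at a1 a2 ⊢ <;> linarith
      simp [cellIso, this, swapPlane_apply, hs, hl]

/-- A sequence of rectangles, with centres `(x n, y n)` and half-sides `a n`, `b n`, each of which
is mapped into the next one. The predicate `s` changes whenever the coordinates are exchanged. -/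
structure IsRectOrbit (lam mu : ℝ) (h : ℝ → ℝ) (x y a b H : ℕ → ℝ) (s : ℕ → Prop) : Prop where
  side : ∀ n, ((s (n + 1) ↔ s n) ∧ x n + a n ≤ 1) ∨ (¬ (s (n + 1) ↔ s n) ∧ 1 ≤ x n - a n)
  const : ∀ n, ∀ t ∈ Ioo (x n - a n) (x n + a n), h t = H n
  disj : ∀ m n, ∀ t ∈ Ioo (x m - a m) (x m + a m), t ∈ Ioo (x n - a n) (x n + a n) → m = n
  step : ∀ n, ∀ z ∈ openRect (x n - a n) (x n + a n) (y n - b n) (y n + b n),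
    z ∈ (foldingMap lam mu h).dom ambientRect → (foldingMap lam mu h).toFun z ∈
      openRect (x (n + 1) - a (n + 1)) (x (n + 1) + a (n + 1))
        (y (n + 1) - b (n + 1)) (y (n + 1) + b (n + 1))
  init : openRect (x 0 - a 0) (x 0 + a 0) (y 0 - b 0) (y 0 + b 0) ⊆ ambientRect
  start : ¬ s 0

namespace IsRectOrbit

variable {lam mu : ℝ} {h : ℝ → ℝ} {x y a b H : ℕ → ℝ} {s : ℕ → Prop}

theorem iterate_mem (O : IsRectOrbit lam mu h x y a b H s) {z : Plane}
    (hz : z ∈ openRect (x 0 - a 0) (x 0 + a 0) (y 0 - b 0) (y 0 + b 0)) (n : ℕ)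
    (hd : ∀ k < n, (foldingMap lam mu h).toFun^[k] z ∈ (foldingMap lam mu h).dom ambientRect) :
    (foldingMap lam mu h).toFun^[n] z ∈
      openRect (x n - a n) (x n + a n) (y n - b n) (y n + b n) := by
  induction n with
  | zero => exact hz
  | succ n ih =>
    rw [Function.iterate_succ_apply']
    exact O.step n _ (ih fun k hk => hd k (by omega)) (hd n (by omega))

/-- The abscissa of a point of the image determines the time, because the horizontal sides of the
rectangles are disjoint. -/
theorem isWandering (O : IsRectOrbit lam mu h x y a b H s) :
    (foldingMap lam mu h).IsWandering ambientRect
      (openRect (x 0 - a 0) (x 0 + a 0) (y 0 - b 0) (y 0 + b 0)) := by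
  intro m n hmn
  rw [Set.disjoint_left]
  rintro w ⟨z, ⟨hz, hzd⟩, rfl⟩ ⟨z', ⟨hz', hzd'⟩, he⟩
  have h1 := O.iterate_mem hz m hzd
  have h2 := O.iterate_mem hz' n hzd'
  rw [he] at h2
  exact hmn (O.disj m n _ h1.1 h2.1)

/-- A point that fails within `k + 1` steps lies on the grid or is sent to a point of the next
rectangle failing within `k` steps. Over the rectangle `h` is constant, so the second case is
covered by preimages of a null set under six invertible affine maps. -/
theorem volume_not_regular (O : IsRectOrbit lam mu h x y a b H s) (hlam : 0 < lam) (hmu : 0 < mu)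
    (hmaps : MapsTo (foldingMap lam mu h).toFun ((foldingMap lam mu h).dom ambientRect) ambientRect)
    (k n : ℕ) :
    volume {z ∈ openRect (x n - a n) (x n + a n) (y n - b n) (y n + b n) ∩ ambientRect |
      ∃ j < k, (foldingMap lam mu h).toFun^[j] z ∉ (foldingMap lam mu h).dom ambientRect} = 0 := by
  induction k generalizing n with
  | zero => simp
  | succ k ih =>
    set Z := {z ∈ openRect (x (n + 1) - a (n + 1)) (x (n + 1) + a (n + 1))
      (y (n + 1) - b (n + 1)) (y (n + 1) + b (n + 1)) ∩ ambientRect |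
      ∃ j < k, (foldingMap lam mu h).toFun^[j] z ∉ (foldingMap lam mu h).dom ambientRect} with hZ
    refine measure_mono_null (t := (ambientRect \ (foldingMap lam mu h).dom ambientRect) ∪
      ⋃ i, shearMap (cellIso i) lam (cellX i) (cellSign i * mu) (cellBase i) (fun _ => H n) ⁻¹' Z)
      ?_ (measure_union_null (volume_ambientRect_diff_dom lam mu h) (measure_iUnion_null fun i => ?_))
    · rintro z ⟨⟨hz, hza⟩, j, hj, hjd⟩
      by_cases hzd : z ∈ (foldingMap lam mu h).dom ambientRect
      · right
        obtain ⟨i, hi⟩ := mem_iUnion.1 (dom_foldingMap lam mu h ▸ hzd)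
        refine mem_iUnion.2 ⟨i, ?_⟩
        have h1 : shearMap (cellIso i) lam (cellX i) (cellSign i * mu) (cellBase i)
            (fun _ => H n) z = (foldingMap lam mu h).toFun z := by
          rw [← branch_eqOn lam mu h i hi]
          simp only [branch, shearMap, O.const n _ hz.1]
        rw [mem_preimage, h1]
        refine ⟨⟨O.step n z hz hzd, hmaps hzd⟩, ?_⟩
        cases j with
        | zero => exact absurd hzd hjd
        | succ j =>
          refine ⟨j, by omega, ?_⟩
          rwa [Function.iterate_succ_apply] at hjd
      · exact Or.inl ⟨hza, hzd⟩
    · have h1 := abs_cellSign i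
      have : cellSign i ≠ 0 := fun h => by simp [h] at h1
      exact volume_preimage_shearMap_const _ _ _ _ hlam.ne' (mul_ne_zero this hmu.ne') (ih (n + 1))

theorem ae_regular (O : IsRectOrbit lam mu h x y a b H s) (hlam : 0 < lam) (hmu : 0 < mu)
    (hmaps : MapsTo (foldingMap lam mu h).toFun ((foldingMap lam mu h).dom ambientRect)
      ambientRect) :
    ∀ᵐ z ∂(volume.restrict (openRect (x 0 - a 0) (x 0 + a 0) (y 0 - b 0) (y 0 + b 0))),
      z ∈ openRect (x 0 - a 0) (x 0 + a 0) (y 0 - b 0) (y 0 + b 0) ∧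
        z ∈ (foldingMap lam mu h).regularPoints ambientRect := by
  rw [ae_restrict_iff' (isOpen_openRect _ _ _ _).measurableSet]
  have h1 := measure_iUnion_null fun k => O.volume_not_regular hlam hmu hmaps k 0
  filter_upwards [compl_mem_ae_iff.2 h1] with z hz hzR
  refine ⟨hzR, fun n => ?_⟩
  by_contra hcon
  exact hz (mem_iUnion.2 ⟨n + 1, ⟨hzR, O.init hzR⟩, n, Nat.lt_succ_self n, hcon⟩)

variable [DecidablePred s]

/-- When `s n` holds the coordinates have been exchanged an odd number of times: the image of the
first axis is vertical and is stretched by `mu`. Otherwise it is horizontal and is stretched by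
`lam`. -/
theorem exists_hasFDerivAt_iterate (O : IsRectOrbit lam mu h x y a b H s) (hlam : 0 < lam)
    (hmu : 0 < mu) {z : Plane}
    (hz : z ∈ openRect (x 0 - a 0) (x 0 + a 0) (y 0 - b 0) (y 0 + b 0))
    (hr : z ∈ (foldingMap lam mu h).regularPoints ambientRect) (n : ℕ) :
    ∃ A : Plane →L[ℝ] Plane, HasFDerivAt ((foldingMap lam mu h).toFun^[n]) A z ∧
      ∀ v, (¬ s n → |A v 0| = lam ^ Nat.count (fun k => ¬ s k) n * mu ^ Nat.count s n * |v 0| ∧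
          |A v 1| = lam ^ Nat.count s n * mu ^ Nat.count (fun k => ¬ s k) n * |v 1|) ∧
        (s n → |A v 1| = lam ^ Nat.count (fun k => ¬ s k) n * mu ^ Nat.count s n * |v 0| ∧
          |A v 0| = lam ^ Nat.count s n * mu ^ Nat.count (fun k => ¬ s k) n * |v 1|) := by
  induction n with
  | zero =>
    refine ⟨ContinuousLinearMap.id ℝ Plane, hasFDerivAt_id z, fun v => ⟨fun _ => ?_, fun h => ?_⟩⟩
    · simp
    · exact absurd h O.start
  | succ n ih =>
    obtain ⟨A, hA, hAv⟩ := ih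
    set w := (foldingMap lam mu h).toFun^[n] z with hw
    have hwR := O.iterate_mem hz n fun k _ => hr k
    have hh : HasDerivAt h 0 (w 0) := by
      refine (hasDerivAt_const (w 0) (H n)).congr_of_eventuallyEq ?_
      filter_upwards [isOpen_Ioo.mem_nhds hwR.1] with t ht
      exact O.const n t ht
    obtain ⟨B, hB, hBv⟩ := foldingMap_hasFDerivAt hlam hmu (hr n) hh
    refine ⟨B.comp A, ?_, fun v => ?_⟩
    · rw [Function.iterate_succ']
      exact hB.comp z hA
    · obtain ⟨hw1, hw2⟩ := hwR.1
      obtain ⟨e1, e2⟩ := hAv v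
      obtain ⟨f1, f2⟩ := hBv (A v)
      simp only [Nat.count_succ, ContinuousLinearMap.comp_apply]
      rcases O.side n with ⟨hs, hx⟩ | ⟨hs, hx⟩
      · obtain ⟨g1, g2⟩ := f1 (lt_of_lt_of_le hw2 hx)
        by_cases hsn : s n
        · obtain ⟨k1, k2⟩ := e2 hsn
          refine ⟨fun hn => absurd (hs.2 hsn) hn, fun _ => ?_⟩
          rw [g1, g2, k1, k2]
          simp only [hsn, not_true, if_true, if_false, add_zero, pow_succ]
          constructor <;> ring
        · obtain ⟨k1, k2⟩ := e1 hsn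
          refine ⟨fun _ => ?_, fun hn => absurd (hs.1 hn) hsn⟩
          rw [g1, g2, k1, k2]
          simp only [hsn, not_false_eq_true, if_true, if_false, add_zero, pow_succ]
          constructor <;> ring
      · obtain ⟨g1, g2⟩ := f2 (lt_of_le_of_lt hx hw1)
        by_cases hsn : s n
        · obtain ⟨k1, k2⟩ := e2 hsn
          refine ⟨fun _ => ?_, fun hn => absurd ⟨fun _ => hsn, fun _ => hn⟩ hs⟩
          rw [g1, g2, k1, k2]
          simp only [hsn, not_true, if_true, if_false, add_zero, pow_succ]
          constructor <;> ring
        · obtain ⟨k1, k2⟩ := e1 hsn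
          refine ⟨fun hn => absurd ⟨fun h => absurd h hn, fun h => absurd h hsn⟩ hs, fun _ => ?_⟩
          rw [g1, g2, k1, k2]
          simp only [hsn, not_false_eq_true, if_true, if_false, add_zero, pow_succ]
          constructor <;> ring

theorem count_not_add_count (s : ℕ → Prop) [DecidablePred s] (n : ℕ) :
    Nat.count (fun k => ¬ s k) n + Nat.count s n = n := by
  induction n with
  | zero => simp
  | succ n ih =>
    simp only [Nat.count_succ]
    by_cases h : s n <;> simp [h] <;> omega

/-- Limit sets of the Lyapunov sequences along an orbit of rectangles whose modes alternate in
long blocks. -/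
theorem omegaLimitSeq_lyapSeq (O : IsRectOrbit lam mu h x y a b H s) (hlam : 1 < lam)
    (hmu : lam < mu) (hhi : ∃ᶠ n in atTop, 3 * n ≤ 4 * Nat.count s n)
    (hlo : ∃ᶠ n in atTop, 4 * Nat.count s n ≤ n) {z : Plane}
    (hz : z ∈ openRect (x 0 - a 0) (x 0 + a 0) (y 0 - b 0) (y 0 + b 0))
    (hr : z ∈ (foldingMap lam mu h).regularPoints ambientRect) {v : Plane} (hv : v ≠ 0) :
    (∃ α β : ℝ, α < β ∧ omegaLimitSeq ((foldingMap lam mu h).lyapSeq z v) = Icc α β) ∧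
      omegaLimitSeq ((foldingMap lam mu h).lyapSeq z v) ⊆ Icc (Real.log lam) (Real.log mu) := by
  refine omegaLimitSeq_growth (x := v 0) (y := v 1)
    (w := fun n => ‖fderiv ℝ ((foldingMap lam mu h).toFun^[n]) z v‖) hlam hmu
    (count_not_add_count s) (fun _ => rfl) (fun n => norm_nonneg _) (fun n => ?_) ?_ hhi hlo
  · obtain ⟨A, hA, hAv⟩ := O.exists_hasFDerivAt_iterate (by linarith) (by linarith) hz hr n
    obtain ⟨e1, e2⟩ := hAv v
    rw [hA.fderiv, norm_sq_plane, ← sq_abs (A v 0), ← sq_abs (A v 1)]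
    by_cases hs : s n
    · obtain ⟨k1, k2⟩ := e2 hs
      rw [k1, k2, mul_pow _ (|v 0|), mul_pow _ (|v 1|), sq_abs, sq_abs]
      ring
    · obtain ⟨k1, k2⟩ := e1 hs
      rw [k1, k2, mul_pow _ (|v 0|), mul_pow _ (|v 1|), sq_abs, sq_abs]
      ring
  · by_contra hcon
    push Not at hcon
    apply hv
    ext i
    fin_cases i
    · exact hcon.1
    · exact hcon.2

end IsRectOrbit

/-! ### Durations and sizes of the excursions -/

/-- Parameters of an orbit of rectangles. -/
structure OrbitParams where
  r : ℕ
  j₀ : ℕ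
  N : ℕ
  lam : ℝ
  mu : ℝ
  one_lt_lam : 1 < lam
  lam_le_mu : lam ≤ mu
  mu_le_sq : mu ≤ lam ^ 2
  -- One halving is worth `64 * (r + 6)` powers of `lam`; this pays for the smallness of the
  -- windows.
  lam_pow : lam ^ (64 * (r + 6)) = 2
  j₀_large : 1 < lam ^ j₀ * (lam - 1)
  N_large : 16 ≤ lam ^ N * (lam - 1)
  two_mul_r_le : 2 * r ≤ N
  two_mul_j₀_le : 2 * (1 + j₀) ≤ N

namespace OrbitParams

variable (p : OrbitParams)

/-- Duration of the `m`-th excursion. -/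
def dur (m : ℕ) : ℕ := p.N * 4 ^ m

/-- Length of the unfolded initial part of the `m`-th excursion. -/
def esc (m : ℕ) : ℕ := m + p.j₀

/-- Half-sides of the rectangle at the beginning of the `m`-th excursion. -/
noncomputable def size : ℕ → ℝ × ℝ
  -- The initial sizes turn the two bounds of `size_bounds` into equalities. The recursion exchanges
  -- the sides: the folded height, halved at every step after the climb, becomes the width.
  | 0 => ((p.lam ^ ((4 * (p.r + 6) + 1) * p.N))⁻¹, (p.lam ^ ((p.r + 6) * p.N))⁻¹)
  | m + 1 => ((size m).2 * p.mu ^ p.dur m / 2 ^ (p.dur m - 1 - p.esc m),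
      (size m).1 * p.lam ^ p.dur m)

/-- Initial half-width of the `m`-th excursion. -/
noncomputable def wid (m : ℕ) : ℝ := (p.size m).1

/-- Initial half-height of the `m`-th excursion. -/
noncomputable def hgt (m : ℕ) : ℝ := (p.size m).2

theorem lam_pos : 0 < p.lam := by linarith [p.one_lt_lam]

theorem mu_pos : 0 < p.mu := by linarith [p.lam_pos, p.lam_le_mu]

theorem one_lt_mu : 1 < p.mu := lt_of_lt_of_le p.one_lt_lam p.lam_le_mu

theorem lam_le : p.lam ≤ 1 + 1 / 64 := by
  have h1 := one_add_mul_sub_le_pow (a := p.lam) (by linarith [p.lam_pos]) (64 * (p.r + 6))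
  rw [p.lam_pow] at h1
  push_cast at h1
  have : (0 : ℝ) ≤ p.r := by positivity
  nlinarith [p.one_lt_lam]

theorem mu_pow_le (k : ℕ) : p.mu ^ k ≤ p.lam ^ (2 * k) := by
  rw [pow_mul]
  exact pow_le_pow_left₀ p.mu_pos.le p.mu_le_sq k

theorem mul_pow_le_one {c : ℝ} (hc : 0 ≤ c) {j k : ℕ} (hjk : j ≤ k) (h : c * p.lam ^ k ≤ 1) :
    c * p.lam ^ j ≤ 1 :=
  (mul_le_mul_of_nonneg_left (pow_le_pow_right₀ p.one_lt_lam.le hjk) hc).trans h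

theorem dur_succ (m : ℕ) : p.dur (m + 1) = 4 * p.dur m := by
  simp only [dur, pow_succ]; ring

theorem N_mul_le_dur (m : ℕ) : p.N * (m + 1) ≤ p.dur m := by
  refine Nat.mul_le_mul_left _ ?_
  exact (Nat.lt_pow_self (by norm_num : 1 < 4))

theorem N_le_dur (m : ℕ) : p.N ≤ p.dur m :=
  le_trans (Nat.le_mul_of_pos_right _ (Nat.succ_pos m)) (p.N_mul_le_dur m)

theorem two_mul_esc_le (m : ℕ) : 2 * (p.esc m + 1) ≤ p.dur m := by
  refine le_trans ?_ (p.N_mul_le_dur m)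
  have h := p.two_mul_j₀_le
  calc 2 * (p.esc m + 1) ≤ 2 * (1 + p.j₀) * (m + 1) := by
        simp only [esc]; nlinarith
    _ ≤ p.N * (m + 1) := Nat.mul_le_mul_right _ h

theorem two_mul_r_mul_le (m : ℕ) : 2 * p.r * (m + 1) ≤ p.dur m :=
  (Nat.mul_le_mul_right _ p.two_mul_r_le).trans (p.N_mul_le_dur m)

/-- The exponents are arranged so that the induction closes. A width becomes a height after growing
by `lam ^ dur m`, while the duration is multiplied by 4, which accounts for `4 * (r + 6) + 1`. The
new width is handled by the halvings. -/
theorem size_bounds (m : ℕ) :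
    (0 < p.wid m ∧ p.wid m * p.lam ^ ((4 * (p.r + 6) + 1) * p.dur m) ≤ 1) ∧
      0 < p.hgt m ∧ p.hgt m * p.lam ^ ((p.r + 6) * p.dur m) ≤ 1 := by
  have l0 := p.lam_pos
  have m0 := p.mu_pos
  induction m with
  | zero =>
    simp only [wid, hgt, size, dur, pow_zero, mul_one]
    refine ⟨⟨by positivity, ?_⟩, by positivity, ?_⟩ <;>
      exact (inv_mul_cancel₀ (by positivity)).le
  | succ m ih =>
    obtain ⟨⟨ha0, ha⟩, hb0, hb⟩ := ih
    have e1 : p.wid (m + 1) = p.hgt m * p.mu ^ p.dur m / 2 ^ (p.dur m - 1 - p.esc m) := rfl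
    have e2 : p.hgt (m + 1) = p.wid m * p.lam ^ p.dur m := rfl
    rw [e1, e2]
    refine ⟨⟨by positivity, ?_⟩, by positivity, ?_⟩
    · rw [div_mul_eq_mul_div, div_le_one (by positivity)]
      have hb1 : p.hgt m ≤ 1 := by
        simpa using p.mul_pow_le_one hb0.le (Nat.zero_le _) hb
      have h2 := p.two_mul_esc_le m
      calc p.hgt m * p.mu ^ p.dur m * p.lam ^ ((4 * (p.r + 6) + 1) * p.dur (m + 1))
          ≤ 1 * p.lam ^ (2 * p.dur m) * p.lam ^ ((4 * (p.r + 6) + 1) * p.dur (m + 1)) := by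
            gcongr
            exact p.mu_pow_le _
        _ = p.lam ^ (2 * p.dur m + (4 * (p.r + 6) + 1) * p.dur (m + 1)) := by
            rw [one_mul, ← pow_add]
        -- At least half of the steps halve, so the right exponent is at least `32 * (r + 6) * dur
        -- m`, while `(16 * (r + 6) + 6) * dur m` is needed.
        _ ≤ p.lam ^ (64 * (p.r + 6) * (p.dur m - 1 - p.esc m)) := by
            refine pow_le_pow_right₀ p.one_lt_lam.le ?_
            rw [p.dur_succ]
            obtain ⟨t, ht⟩ : ∃ t, p.dur m - 1 - p.esc m = t := ⟨_, rfl⟩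
            have ht2 : p.dur m ≤ 2 * t := by omega
            rw [ht]
            nlinarith [Nat.zero_le p.r]
        _ = 2 ^ (p.dur m - 1 - p.esc m) := by rw [pow_mul, p.lam_pow]
    · rw [p.dur_succ, mul_assoc, ← pow_add]
      refine le_of_eq_of_le ?_ ha
      congr 2
      ring

theorem wid_pos (m : ℕ) : 0 < p.wid m := (p.size_bounds m).1.1

theorem hgt_pos (m : ℕ) : 0 < p.hgt m := (p.size_bounds m).2.1

/-- Even after the climb the rectangle is thin compared with `lam - 1`. This keeps it below y = 1
before the last step of the climb and makes it small relative to its window. -/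
theorem hgt_mul_le (m : ℕ) : 16 * (p.hgt m * p.mu ^ p.esc m) ≤ p.lam - 1 := by
  have l1 := p.one_lt_lam
  have l0 := p.lam_pos
  have hb := (p.size_bounds m).2.2
  have hb0 := p.hgt_pos m
  have h1 : p.hgt m * p.lam ^ (2 * p.esc m + p.N) ≤ 1 := by
    refine p.mul_pow_le_one hb0.le ?_ hb
    have h2 := p.two_mul_esc_le m
    have h3 := p.N_le_dur m
    nlinarith [Nat.zero_le p.r]
  have h2 : p.hgt m * p.mu ^ p.esc m * p.lam ^ p.N ≤ 1 := by
    rw [pow_add, ← mul_assoc] at h1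
    refine le_trans ?_ h1
    gcongr
    exact p.mu_pow_le _
  have h3 : 0 ≤ p.hgt m * p.mu ^ p.esc m := mul_nonneg hb0.le (pow_nonneg p.mu_pos.le _)
  have h4 := mul_le_mul_of_nonneg_left p.N_large h3
  have h5 := mul_le_mul_of_nonneg_right h2 (by linarith : (0 : ℝ) ≤ p.lam - 1)
  linarith

/-- Distance scale between the exit points. -/
noncomputable def gap (m : ℕ) : ℝ := (p.mu ^ p.esc (m + 1))⁻¹ / p.lam

/-- Abscissa of the centre of the rectangle at the last step of the `m`-th excursion. -/
noncomputable def exit (m : ℕ) : ℝ := 1 + ((p.mu ^ p.esc (m + 1))⁻¹ + p.hgt (m + 1)) / p.lam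

/-- Relative size of the windows. -/
noncomputable def theta : ℝ := (p.lam - 1) / 4

theorem theta_pos : 0 < p.theta := by
  have := p.one_lt_lam
  unfold theta
  linarith

theorem gap_pos (m : ℕ) : 0 < p.gap m := by
  have l0 := p.lam_pos
  have m0 := p.mu_pos
  unfold gap
  positivity

theorem exit_eq (m : ℕ) : p.exit m = 1 + p.gap m + p.hgt (m + 1) / p.lam := by
  unfold exit gap
  ring

theorem hgt_succ_le (m : ℕ) : 2 * (p.hgt (m + 1) / p.lam) ≤ p.theta * p.gap m / 2 := by
  have l0 := p.lam_pos
  have m0 := p.mu_pos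
  have h := p.hgt_mul_le (m + 1)
  unfold theta gap
  have e : 0 < p.mu ^ p.esc (m + 1) := by positivity
  rw [div_eq_mul_inv, div_eq_mul_inv _ p.lam]
  have h1 : p.hgt (m + 1) * 16 ≤ (p.lam - 1) * (p.mu ^ p.esc (m + 1))⁻¹ := by
    rw [← div_eq_mul_inv, le_div_iff₀ e]
    linarith
  have h2 := mul_le_mul_of_nonneg_right h1 (inv_pos.2 l0).le
  nlinarith

/-- The exit windows stay inside (1, λ), a fundamental domain of x ↦ λx, so that rescaled windows
with different numbers of remaining steps cannot meet. -/
theorem gap_upper (m : ℕ) : 1 + p.gap m * (1 + p.theta) < p.lam := by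
  have l1 := p.one_lt_lam
  have l0 := p.lam_pos
  have m0 := p.mu_pos
  have h1 : p.gap m * (1 + p.theta) ≤ (p.lam ^ p.j₀)⁻¹ := by
    have h2 : 1 + p.theta ≤ p.lam := by unfold theta; linarith
    have h3 : (p.mu ^ p.esc (m + 1))⁻¹ ≤ (p.lam ^ p.j₀)⁻¹ := by
      gcongr
      calc p.lam ^ p.j₀ ≤ p.lam ^ p.esc (m + 1) :=
            pow_le_pow_right₀ l1.le (by unfold esc; omega)
        _ ≤ p.mu ^ p.esc (m + 1) := pow_le_pow_left₀ l0.le p.lam_le_mu _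
    calc p.gap m * (1 + p.theta) ≤ p.gap m * p.lam := by gcongr; exact (p.gap_pos m).le
      _ = (p.mu ^ p.esc (m + 1))⁻¹ := by unfold gap; field_simp
      _ ≤ _ := h3
  have h2 : (p.lam ^ p.j₀)⁻¹ < p.lam - 1 := by
    rw [inv_lt_iff_one_lt_mul₀ (by positivity)]
    linarith [p.j₀_large]
  linarith

/-- Successive gaps shrink at least by the factor `mu`, and `theta` is small enough that windows of
relative radius `theta` around them are disjoint. -/
theorem gap_lt {m n : ℕ} (hmn : m < n) : p.gap n * (1 + p.theta) ≤ p.gap m * (1 - p.theta) := by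
  have l1 := p.one_lt_lam
  have l0 := p.lam_pos
  have m0 := p.mu_pos
  have hl := p.lam_le
  have hgm := p.gap_pos m
  have h1 : p.gap n * p.mu ≤ p.gap m := by
    unfold gap
    rw [div_mul_eq_mul_div]
    gcongr
    rw [inv_mul_le_iff₀ (by positivity), ← div_eq_mul_inv, le_div_iff₀ (by positivity), mul_comm,
      ← pow_succ]
    exact pow_le_pow_right₀ p.one_lt_mu.le (by unfold esc; omega)
  have h2 : 1 + p.theta ≤ p.lam * (1 - p.theta) := by
    unfold theta
    nlinarith
  have h3 : 0 ≤ 1 - p.theta := by unfold theta; linarith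
  calc p.gap n * (1 + p.theta) ≤ p.gap n * (p.lam * (1 - p.theta)) :=
        mul_le_mul_of_nonneg_left h2 (p.gap_pos n).le
    _ ≤ p.gap n * (p.mu * (1 - p.theta)) := by
        gcongr
        · exact (p.gap_pos n).le
        · exact p.lam_le_mu
    _ = p.gap n * p.mu * (1 - p.theta) := by ring
    _ ≤ p.gap m * (1 - p.theta) := by gcongr

/-! ### The clock of the excursions -/

/-- Excursion and step within the excursion at time `n`. -/
def state : ℕ → ℕ × ℕ
  | 0 => (0, 0)
  | n + 1 => if (state n).2 + 1 < p.dur (state n).1 then ((state n).1, (state n).2 + 1)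
      else ((state n).1 + 1, 0)

/-- Starting time of the `m`-th excursion. -/
def tstart : ℕ → ℕ
  | 0 => 0
  | m + 1 => tstart m + p.dur m

theorem dur_pos (m : ℕ) : 0 < p.dur m := by
  have h1 := p.two_mul_esc_le m
  omega

/-- A geometric sum of ratio 4: each excursion lasts at least three times as long as everything
before it. -/
theorem three_mul_tstart_le (m : ℕ) : 3 * p.tstart m ≤ p.dur m := by
  induction m with
  | zero => simp [tstart]
  | succ m ih =>
    rw [p.dur_succ]
    simp only [tstart]
    omega

theorem state_lt (n : ℕ) : (p.state n).2 < p.dur (p.state n).1 := by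
  induction n with
  | zero => exact p.dur_pos 0
  | succ n ih =>
    simp only [state]
    split_ifs with h
    · exact h
    · exact p.dur_pos _

theorem tstart_add_state (n : ℕ) : p.tstart (p.state n).1 + (p.state n).2 = n := by
  induction n with
  | zero => simp [state, tstart]
  | succ n ih =>
    have h1 := p.state_lt n
    simp only [state]
    split_ifs with h
    · simp only
      omega
    · simp only [tstart]
      omega

theorem state_injective {m n : ℕ} (h : p.state m = p.state n) : m = n := by
  rw [← p.tstart_add_state m, ← p.tstart_add_state n, h]

theorem state_tstart_add (m k : ℕ) (hk : k < p.dur m) : p.state (p.tstart m + k) = (m, k) := by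
  induction m generalizing k with
  | zero =>
    induction k with
    | zero => simp [tstart, state]
    | succ k ih =>
      rw [← add_assoc, state, ih (by omega)]
      simp [hk]
  | succ m ihm =>
    induction k with
    | zero =>
      have h1 := p.dur_pos m
      have h2 : p.tstart (m + 1) + 0 = p.tstart m + (p.dur m - 1) + 1 := by
        simp only [tstart]; omega
      rw [h2, state, ihm _ (by omega)]
      simp
      omega
    | succ k ih =>
      rw [← add_assoc, state, ih (by omega)]
      simp [hk]

/-- The second mode: odd excursions. -/
def oddMode (n : ℕ) : Prop := Odd (p.state n).1

instance : DecidablePred p.oddMode := fun n => inferInstanceAs (Decidable (Odd (p.state n).1))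

/-- The excursion that has just ended fills at least three quarters of the elapsed time, and it was
spent entirely in the odd mode. -/
theorem count_oddMode_odd {m : ℕ} (hm : Odd m) :
    3 * p.tstart (m + 1) ≤ 4 * Nat.count p.oddMode (p.tstart (m + 1)) := by
  have h1 : Nat.count (fun k => p.oddMode (p.tstart m + k)) (p.dur m) = p.dur m := by
    rw [Nat.count_iff_forall]
    intro k hk
    simp only [oddMode, p.state_tstart_add m k hk, hm]
  have h2 := p.three_mul_tstart_le m
  simp only [tstart, Nat.count_add, h1]
  omega

theorem count_oddMode_even {m : ℕ} (hm : ¬ Odd m) :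
    4 * Nat.count p.oddMode (p.tstart (m + 1)) ≤ p.tstart (m + 1) := by
  have h1 : Nat.count (fun k => p.oddMode (p.tstart m + k)) (p.dur m) = 0 := by
    rw [Nat.count_iff_forall_not]
    intro k hk
    simp only [oddMode, p.state_tstart_add m k hk, hm, not_false_eq_true]
  have h2 := p.three_mul_tstart_le m
  have h3 := Nat.count_le (p := p.oddMode) (n := p.tstart m)
  simp only [tstart, Nat.count_add, h1]
  omega

theorem le_tstart (m : ℕ) : m ≤ p.tstart m := by
  induction m with
  | zero => simp
  | succ m ih =>
    have := p.dur_pos m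
    simp only [tstart]
    omega

theorem frequently_count_oddMode_ge : ∃ᶠ n in atTop, 3 * n ≤ 4 * Nat.count p.oddMode n := by
  rw [frequently_atTop]
  intro M
  refine ⟨p.tstart (2 * M + 1 + 1), ?_, p.count_oddMode_odd (odd_two_mul_add_one M)⟩
  have := p.le_tstart (2 * M + 1 + 1)
  omega

theorem frequently_count_oddMode_le : ∃ᶠ n in atTop, 4 * Nat.count p.oddMode n ≤ n := by
  rw [frequently_atTop]
  intro M
  refine ⟨p.tstart (2 * M + 1), ?_, p.count_oddMode_even (by simp)⟩
  have := p.le_tstart (2 * M + 1)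
  omega

end OrbitParams

/-! ### Windows, rectangles and the cost of the shifts -/

namespace OrbitParams

variable (p : OrbitParams)

/-- Centre of the window of step `k` of the `m`-th excursion. -/
noncomputable def winC (m k : ℕ) : ℝ := (1 + p.gap m) / p.lam ^ (p.dur m - 1 - k)

/-- Radius of the window of step `k` of the `m`-th excursion. -/
noncomputable def winR (m k : ℕ) : ℝ := p.theta * p.gap m / p.lam ^ (p.dur m - 1 - k)

/-- Abscissa of the centre of the rectangle. -/
noncomputable def cenX (m k : ℕ) : ℝ := p.exit m / p.lam ^ (p.dur m - 1 - k)

/-- Half-width of the rectangle. -/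
noncomputable def halfW (m k : ℕ) : ℝ := p.wid m * p.lam ^ k

/-- Half-height of the rectangle. -/
noncomputable def halfH (m k : ℕ) : ℝ := p.hgt m * p.mu ^ k / 2 ^ (k - (p.esc m + 1))

/-- Ordinate of the centre of the rectangle. -/
noncomputable def cenY (m k : ℕ) : ℝ :=
  if k ≤ p.esc m then (p.mu ^ (p.esc m - k))⁻¹ + p.hgt m * p.mu ^ k else 0

/-- Vertical shift applied to the rectangle. -/
noncomputable def shift (m k : ℕ) : ℝ :=
  if k < p.esc m then 0
  else if k = p.esc m then -(p.mu * p.halfH m k)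
  else if k + 1 < p.dur m then -(p.mu * p.halfH m k / 2)
  else p.cenX (m + 1) 0 - p.mu * p.halfH m k / 2

theorem winR_pos (m k : ℕ) : 0 < p.winR m k := by
  have l0 := p.lam_pos
  have := p.theta_pos
  have := p.gap_pos m
  unfold winR
  positivity

theorem theta_lt_one : p.theta < 1 := by
  have := p.lam_le
  unfold theta
  linarith

theorem winR_le_one (m k : ℕ) : p.winR m k ≤ 1 := by
  have l0 := p.lam_pos
  have l1 := p.lam_le
  have h1 := p.gap_upper m
  have h2 := p.gap_pos m
  have h3 := p.theta_pos
  have h4 : (1 : ℝ) ≤ p.lam ^ (p.dur m - 1 - k) := one_le_pow₀ p.one_lt_lam.le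
  unfold winR
  rw [div_le_one (by positivity)]
  nlinarith

theorem mem_window_iff {m k : ℕ} {t : ℝ} : |t - p.winC m k| < p.winR m k ↔
    |t * p.lam ^ (p.dur m - 1 - k) - (1 + p.gap m)| < p.theta * p.gap m := by
  have l0 := p.lam_pos
  have e : 0 < p.lam ^ (p.dur m - 1 - k) := by positivity
  unfold winC winR
  rw [lt_div_iff₀ e, ← abs_of_pos e, ← abs_mul, abs_of_pos e, sub_mul, div_mul_cancel₀ _ e.ne']

theorem window_bounds {m k : ℕ} {t : ℝ} (h : |t - p.winC m k| < p.winR m k) :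
    1 + p.gap m * (1 - p.theta) < t * p.lam ^ (p.dur m - 1 - k) ∧
      t * p.lam ^ (p.dur m - 1 - k) < 1 + p.gap m * (1 + p.theta) := by
  obtain ⟨h1, h2⟩ := abs_lt.1 (p.mem_window_iff.1 h)
  constructor <;> linarith

theorem window_bounds' {m k : ℕ} {t : ℝ} (h : |t - p.winC m k| < p.winR m k) :
    1 < t * p.lam ^ (p.dur m - 1 - k) ∧ t * p.lam ^ (p.dur m - 1 - k) < p.lam := by
  obtain ⟨h1, h2⟩ := p.window_bounds h
  have h3 := p.gap_upper m
  have h4 := mul_pos (p.gap_pos m) (sub_pos.2 p.theta_lt_one)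
  constructor <;> linarith

/-- Rescaling to the exit puts a point of a window into (1, λ), which determines the number of
remaining steps. The rescaled position relative to the gaps then determines the excursion. -/
theorem window_disjoint {m k m' k' : ℕ} (hk : k < p.dur m) (hk' : k' < p.dur m') {t : ℝ}
    (h : |t - p.winC m k| < p.winR m k) (h' : |t - p.winC m' k'| < p.winR m' k') :
    (m, k) = (m', k') := by
  have l0 := p.lam_pos
  have key : ∀ i i' : ℕ, i < i' → 1 < t * p.lam ^ i → t * p.lam ^ i' < p.lam → False := by
    intro i i' hii h1 h2
    have ht : 0 < t := by
      by_contra hcon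
      have : t * p.lam ^ i ≤ 0 := mul_nonpos_of_nonpos_of_nonneg (not_lt.1 hcon) (by positivity)
      linarith
    have h3 : t * p.lam ^ (i + 1) ≤ t * p.lam ^ i' :=
      mul_le_mul_of_nonneg_left (pow_le_pow_right₀ p.one_lt_lam.le hii) ht.le
    rw [pow_succ, ← mul_assoc] at h3
    nlinarith
  obtain ⟨h1, h2⟩ := p.window_bounds' h
  obtain ⟨h1', h2'⟩ := p.window_bounds' h'
  have hi : p.dur m - 1 - k = p.dur m' - 1 - k' := by
    rcases lt_trichotomy (p.dur m - 1 - k) (p.dur m' - 1 - k') with hlt | heq | hgt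
    · exact (key _ _ hlt h1 h2').elim
    · exact heq
    · exact (key _ _ hgt h1' h2).elim
  obtain ⟨g1, g2⟩ := p.window_bounds h
  obtain ⟨g1', g2'⟩ := p.window_bounds h'
  rw [hi] at g1 g2
  have hm : m = m' := by
    rcases lt_trichotomy m m' with hlt | heq | hgt
    · linarith [p.gap_lt hlt]
    · exact heq
    · linarith [p.gap_lt hgt]
  subst hm
  rw [Prod.mk.injEq]
  refine ⟨rfl, by omega⟩

/-- The rectangles, rescaled to the exit. -/
theorem mem_rect_scaled {m k : ℕ} (hk : k < p.dur m) {t : ℝ}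
    (ht : t ∈ Ioo (p.cenX m k - p.halfW m k) (p.cenX m k + p.halfW m k)) :
    1 + p.gap m < t * p.lam ^ (p.dur m - 1 - k) ∧
      t * p.lam ^ (p.dur m - 1 - k) < 1 + p.gap m + 2 * (p.hgt (m + 1) / p.lam) := by
  have l0 := p.lam_pos
  set i := p.dur m - 1 - k with hi
  have e : 0 < p.lam ^ i := by positivity
  have h1 : p.cenX m k * p.lam ^ i = p.exit m := by
    unfold cenX
    rw [← hi, div_mul_cancel₀ _ e.ne']
  have h2 : p.halfW m k * p.lam ^ i = p.hgt (m + 1) / p.lam := by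
    have e2 : p.hgt (m + 1) = p.wid m * p.lam ^ p.dur m := rfl
    have e3 : p.dur m = k + i + 1 := by omega
    unfold halfW
    rw [e2, e3, pow_succ, pow_add]
    field_simp
  obtain ⟨h3, h4⟩ := ht
  have h5 := mul_lt_mul_of_pos_right h3 e
  have h6 := mul_lt_mul_of_pos_right h4 e
  rw [sub_mul, h1, h2, exit_eq] at h5
  rw [add_mul, h1, h2, exit_eq] at h6
  constructor <;> linarith

/-- The half radius is what is needed: there the bump takes its full value, so `h` is constant over
the rectangle. -/
theorem rect_subset_window {m k : ℕ} (hk : k < p.dur m) {t : ℝ}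
    (ht : t ∈ Ioo (p.cenX m k - p.halfW m k) (p.cenX m k + p.halfW m k)) :
    |t - p.winC m k| ≤ p.winR m k / 2 := by
  have l0 := p.lam_pos
  have e : 0 < p.lam ^ (p.dur m - 1 - k) := by positivity
  obtain ⟨h1, h2⟩ := p.mem_rect_scaled hk ht
  have h3 := p.hgt_succ_le m
  unfold winC winR
  rw [div_div, le_div_iff₀ (by positivity), mul_comm (p.lam ^ _), mul_comm (2 : ℝ), ← mul_comm (2 : ℝ),
    mul_comm (2 : ℝ), ← mul_assoc, ← abs_of_pos e, ← abs_mul, abs_of_pos e, sub_mul,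
    div_mul_cancel₀ _ e.ne', abs_of_pos (by linarith)]
  linarith

theorem halfH_pos (m k : ℕ) : 0 < p.halfH m k := by
  have m0 := p.mu_pos
  have := p.hgt_pos m
  unfold halfH
  positivity

theorem halfW_pos (m k : ℕ) : 0 < p.halfW m k := by
  have l0 := p.lam_pos
  have := p.wid_pos m
  unfold halfW
  positivity

theorem halfH_le (m k : ℕ) : p.halfH m k ≤ p.hgt m * p.mu ^ k := by
  have m0 := p.mu_pos
  have := p.hgt_pos m
  unfold halfH
  exact div_le_self (by positivity) (one_le_pow₀ (by norm_num))

/-- The halvings are not needed here, since the initial height is small enough. Of the exponent `r +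
4`, the share `r` pays for the narrowest window, 1 for the gap, and 3 are left for summability. -/
theorem mu_mul_halfH_le {m k : ℕ} (hk : k < p.dur m) :
    p.mu * p.halfH m k * p.lam ^ ((p.r + 4) * p.dur m) ≤ 1 := by
  have m0 := p.mu_pos
  have l0 := p.lam_pos
  have hb0 := p.hgt_pos m
  have h1 : p.mu * p.halfH m k ≤ p.hgt m * p.lam ^ (2 * p.dur m) := by
    calc p.mu * p.halfH m k ≤ p.mu * (p.hgt m * p.mu ^ k) := by gcongr; exact p.halfH_le m k
      _ = p.hgt m * p.mu ^ (k + 1) := by ring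
      _ ≤ p.hgt m * p.mu ^ p.dur m := by
          gcongr
          · exact p.one_lt_mu.le
          · exact hk
      _ ≤ p.hgt m * p.lam ^ (2 * p.dur m) := by gcongr; exact p.mu_pow_le _
  calc p.mu * p.halfH m k * p.lam ^ ((p.r + 4) * p.dur m)
      ≤ p.hgt m * p.lam ^ (2 * p.dur m) * p.lam ^ ((p.r + 4) * p.dur m) := by gcongr
    _ = p.hgt m * p.lam ^ ((p.r + 6) * p.dur m) := by
        rw [mul_assoc, ← pow_add]; congr 2; ring
    _ ≤ 1 := (p.size_bounds m).2.2

theorem halfH_lt_one {m k : ℕ} (hk : k < p.dur m) : p.halfH m k < 1 := by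
  have h1 := p.mul_pow_le_one (mul_pos p.mu_pos (p.halfH_pos m k)).le (Nat.zero_le _)
    (p.mu_mul_halfH_le hk)
  rw [pow_zero, mul_one] at h1
  nlinarith [p.halfH_pos m k, p.one_lt_mu]

theorem exit_bounds (m : ℕ) : 1 < p.exit m ∧ p.exit m < p.lam := by
  have h1 := p.hgt_succ_le m
  have h2 := p.gap_upper m
  have h3 := p.gap_pos m
  have h4 : 0 < p.hgt (m + 1) / p.lam := div_pos (p.hgt_pos _) p.lam_pos
  have h5 := mul_pos h3 p.theta_pos
  rw [p.exit_eq]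
  constructor <;> linarith

theorem cenX_zero_ge (m : ℕ) : 1 ≤ p.cenX (m + 1) 0 * p.lam ^ (4 * p.dur m) := by
  have l0 := p.lam_pos
  have h1 := p.exit_bounds (m + 1)
  unfold cenX
  rw [Nat.sub_zero, ← p.dur_succ, div_mul_eq_mul_div, le_div_iff₀ (by positivity), one_mul]
  have h2 : p.lam ^ (p.dur (m + 1) - 1) ≤ p.lam ^ p.dur (m + 1) :=
    pow_le_pow_right₀ p.one_lt_lam.le (Nat.sub_le _ _)
  have h3 : 0 < p.lam ^ p.dur (m + 1) := by positivity
  nlinarith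

theorem cenX_zero_le (m : ℕ) : p.cenX (m + 1) 0 * p.lam ^ (4 * p.dur m) ≤ p.lam ^ 2 := by
  have l0 := p.lam_pos
  have h1 := p.exit_bounds (m + 1)
  unfold cenX
  rw [Nat.sub_zero, ← p.dur_succ, div_mul_eq_mul_div, div_le_iff₀ (by positivity)]
  have e : p.dur (m + 1) = (p.dur (m + 1) - 1) + 1 := by have := p.dur_pos (m + 1); omega
  rw [e, Nat.add_sub_cancel, pow_succ, sq]
  have h3 : 0 < p.lam ^ (p.dur (m + 1) - 1) * p.lam := by positivity
  calc p.exit (m + 1) * (p.lam ^ (p.dur (m + 1) - 1) * p.lam)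
      ≤ p.lam * (p.lam ^ (p.dur (m + 1) - 1) * p.lam) := by gcongr; exact h1.2.le
    _ = _ := by ring

theorem esc_lt_dur (m : ℕ) : p.esc m + 1 < p.dur m := by
  have h := p.two_mul_esc_le m
  omega

/-- The height of the rectangle is at most `lam ^ (-4 * dur m)`, and the starting abscissa of the
next excursion is at least that large. -/
theorem shift_last_nonneg {m k : ℕ} (hk : k + 1 = p.dur m) : 0 ≤ p.shift m k := by
  have l0 := p.lam_pos
  have h1 := p.esc_lt_dur m
  unfold shift
  rw [if_neg (by omega), if_neg (by omega), if_neg (by omega)]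
  have h2 := p.mul_pow_le_one (mul_pos p.mu_pos (p.halfH_pos m k)).le
    (Nat.mul_le_mul_right (p.dur m) (by omega : 4 ≤ p.r + 4)) (p.mu_mul_halfH_le (by omega : k < p.dur m))
  have h3 := p.cenX_zero_ge m
  have h4 : p.mu * p.halfH m k ≤ p.cenX (m + 1) 0 :=
    le_of_mul_le_mul_right (h2.trans h3) (by positivity)
  have h5 := mul_pos p.mu_pos (p.halfH_pos m k)
  linarith

/-- A constant independent of the duration of the excursions. -/
noncomputable def bumpConst (r j₀ : ℕ) (lam : ℝ) : ℝ :=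
  5 * (lam ^ (3 + 2 * j₀) / ((lam - 1) / 4)) ^ r

theorem inv_winR_le (m k : ℕ) : (p.winR m k)⁻¹ ≤
    p.lam ^ (p.dur m - 1 - k) * p.lam ^ (2 * m) * (p.lam ^ (3 + 2 * p.j₀) / p.theta) := by
  have l0 := p.lam_pos
  have m0 := p.mu_pos
  have t0 := p.theta_pos
  have h1 : (p.winR m k)⁻¹ =
      p.lam ^ (p.dur m - 1 - k) * (p.mu ^ p.esc (m + 1) * p.lam) / p.theta := by
    unfold winR gap
    field_simp
  rw [h1]
  have h2 : p.mu ^ p.esc (m + 1) * p.lam ≤ p.lam ^ (2 * m) * p.lam ^ (3 + 2 * p.j₀) := by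
    calc p.mu ^ p.esc (m + 1) * p.lam ≤ p.lam ^ (2 * p.esc (m + 1)) * p.lam := by
          gcongr; exact p.mu_pow_le _
      _ = p.lam ^ (2 * m) * p.lam ^ (3 + 2 * p.j₀) := by
          rw [← pow_succ, ← pow_add]; congr 1; unfold esc; ring
  rw [mul_div_assoc, mul_assoc]
  gcongr
  rw [← mul_div_assoc]
  gcongr

/-- All shifts but the last are bounded by the height, which is tiny. The last one is about `lam ^
(-4 * dur m)`, much larger, but its window is not contracted: only the gap enters its radius, at the
price of `lam ^ dur m`. -/
theorem shift_div_le {m k : ℕ} (hk : k < p.dur m) :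
    |p.shift m k| / p.winR m k ^ p.r ≤ bumpConst p.r p.j₀ p.lam * (p.lam ^ (3 * p.dur m))⁻¹ := by
  have l0 := p.lam_pos
  have l1 := p.one_lt_lam
  have m0 := p.mu_pos
  have t0 := p.theta_pos
  set i := p.dur m - 1 - k with hi
  set D := (p.lam ^ (3 + 2 * p.j₀) / p.theta) ^ p.r with hD
  have hD0 : 0 < D := by positivity
  have hB : bumpConst p.r p.j₀ p.lam = 5 * D := rfl
  set c := p.mu * p.halfH m k with hc
  have hc0 : 0 < c := mul_pos p.mu_pos (p.halfH_pos m k)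
  have hw : (p.winR m k ^ p.r)⁻¹ ≤ p.lam ^ (p.r * i) * p.lam ^ p.dur m * D := by
    rw [← inv_pow]
    calc (p.winR m k)⁻¹ ^ p.r
        ≤ (p.lam ^ i * p.lam ^ (2 * m) * (p.lam ^ (3 + 2 * p.j₀) / p.theta)) ^ p.r :=
          pow_le_pow_left₀ (inv_pos.2 (p.winR_pos m k)).le (p.inv_winR_le m k) _
      _ = p.lam ^ (p.r * i) * p.lam ^ (2 * m * p.r) * D := by
          rw [mul_pow, mul_pow, ← pow_mul, ← pow_mul, mul_comm i]
      _ ≤ p.lam ^ (p.r * i) * p.lam ^ p.dur m * D := by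
          gcongr
          · exact l1.le
          · have := p.two_mul_r_mul_le m
            nlinarith
  have hwpos : 0 < (p.winR m k ^ p.r)⁻¹ := inv_pos.2 (pow_pos (p.winR_pos m k) _)
  have hfold : c * (p.winR m k ^ p.r)⁻¹ ≤ D * (p.lam ^ (3 * p.dur m))⁻¹ := by
    rw [← div_eq_mul_inv D, le_div_iff₀ (by positivity)]
    calc c * (p.winR m k ^ p.r)⁻¹ * p.lam ^ (3 * p.dur m)
        ≤ c * (p.lam ^ (p.r * i) * p.lam ^ p.dur m * D) * p.lam ^ (3 * p.dur m) := by gcongr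
      _ ≤ c * (p.lam ^ (p.r * p.dur m) * p.lam ^ p.dur m * D) * p.lam ^ (3 * p.dur m) := by
          gcongr
          · exact l1.le
          · omega
      _ = c * p.lam ^ ((p.r + 4) * p.dur m) * D := by
          have : (p.r + 4) * p.dur m = p.r * p.dur m + p.dur m + 3 * p.dur m := by ring
          rw [this, pow_add, pow_add]; ring
      _ ≤ 1 * D := by gcongr; exact p.mu_mul_halfH_le hk
      _ = D := one_mul D
  have hle : ∀ s : ℝ, |s| ≤ c → |s| / p.winR m k ^ p.r ≤ 5 * D * (p.lam ^ (3 * p.dur m))⁻¹ := by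
    intro s hs
    rw [div_eq_mul_inv]
    calc |s| * (p.winR m k ^ p.r)⁻¹ ≤ c * (p.winR m k ^ p.r)⁻¹ := by gcongr
      _ ≤ D * (p.lam ^ (3 * p.dur m))⁻¹ := hfold
      _ ≤ 5 * D * (p.lam ^ (3 * p.dur m))⁻¹ := by
          gcongr
          linarith
  rw [hB]
  unfold shift
  rw [← hc]
  split_ifs with h1 h2 h3
  · exact hle 0 (by rw [abs_zero]; exact hc0.le)
  · exact hle _ (by rw [abs_neg, abs_of_pos hc0])
  · exact hle _ (by rw [abs_neg, abs_of_pos (by positivity)]; linarith)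
  -- The last step. The constant 5 is 4 for the displacement, from `lam ^ 2 ≤ 4`, plus 1 for the
  -- fold.
  · have hi0 : i = 0 := by omega
    have hx0 : 0 < p.cenX (m + 1) 0 := by
      have := (p.exit_bounds (m + 1)).1
      unfold cenX
      positivity
    have hd : p.cenX (m + 1) 0 * (p.winR m k ^ p.r)⁻¹ ≤ 4 * D * (p.lam ^ (3 * p.dur m))⁻¹ := by
      rw [← div_eq_mul_inv (4 * D), le_div_iff₀ (by positivity)]
      rw [hi0, mul_zero, pow_zero, one_mul] at hw
      calc p.cenX (m + 1) 0 * (p.winR m k ^ p.r)⁻¹ * p.lam ^ (3 * p.dur m)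
          ≤ p.cenX (m + 1) 0 * (p.lam ^ p.dur m * D) * p.lam ^ (3 * p.dur m) := by gcongr
        _ = p.cenX (m + 1) 0 * p.lam ^ (4 * p.dur m) * D := by
            have : 4 * p.dur m = p.dur m + 3 * p.dur m := by ring
            rw [this, pow_add]; ring
        _ ≤ p.lam ^ 2 * D := by gcongr; exact p.cenX_zero_le m
        _ ≤ 4 * D := by
            gcongr
            nlinarith [p.lam_le]
    have habs : |p.cenX (m + 1) 0 - c / 2| ≤ p.cenX (m + 1) 0 + c := by
      rw [abs_le]
      constructor <;> linarith
    rw [div_eq_mul_inv]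
    calc |p.cenX (m + 1) 0 - c / 2| * (p.winR m k ^ p.r)⁻¹
        ≤ (p.cenX (m + 1) 0 + c) * (p.winR m k ^ p.r)⁻¹ := by gcongr
      _ ≤ 4 * D * (p.lam ^ (3 * p.dur m))⁻¹ + D * (p.lam ^ (3 * p.dur m))⁻¹ := by
          rw [add_mul]; exact add_le_add hd hfold
      _ = _ := by ring

end OrbitParams

/-! ### The rectangles are mapped into one another -/

namespace OrbitParams

variable (p : OrbitParams)

/-- The rectangle at step `k` of the `m`-th excursion. -/
noncomputable def rect (m k : ℕ) : Set Plane :=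
  openRect (p.cenX m k - p.halfW m k) (p.cenX m k + p.halfW m k)
    (p.cenY m k - p.halfH m k) (p.cenY m k + p.halfH m k)

theorem rect_right_le {m k : ℕ} (hk : k + 1 < p.dur m) : p.cenX m k + p.halfW m k ≤ 1 := by
  have l0 := p.lam_pos
  by_contra hcon
  have hw := p.halfW_pos m k
  -- If the rectangle crossed x = 1, this would be one of its abscissae not below 1; rescaling by at
  -- least one factor `lam` would take it out of (1, λ).
  have ht : max 1 (p.cenX m k) ∈ Ioo (p.cenX m k - p.halfW m k) (p.cenX m k + p.halfW m k) :=
    ⟨lt_of_lt_of_le (by linarith) (le_max_right _ _), max_lt (not_le.1 hcon) (by linarith)⟩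
  have h1 := p.rect_subset_window (by omega) ht
  have h2 := p.window_bounds' (lt_of_le_of_lt h1 (by linarith [p.winR_pos m k]))
  have h3 : p.lam ≤ p.lam ^ (p.dur m - 1 - k) :=
    le_self_pow₀ p.one_lt_lam.le (by omega)
  have h4 : (1 : ℝ) ≤ max 1 (p.cenX m k) := le_max_left _ _
  nlinarith

theorem rect_left_ge {m k : ℕ} (hk : k + 1 = p.dur m) : 1 ≤ p.cenX m k - p.halfW m k := by
  by_contra hcon
  have hw := p.halfW_pos m k
  have ht : min 1 (p.cenX m k) ∈ Ioo (p.cenX m k - p.halfW m k) (p.cenX m k + p.halfW m k) :=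
    ⟨lt_min (not_le.1 hcon) (by linarith), lt_of_le_of_lt (min_le_right _ _) (by linarith)⟩
  have h1 := (p.mem_rect_scaled (by omega) ht).1
  have h2 : p.dur m - 1 - k = 0 := by omega
  rw [h2, pow_zero, mul_one] at h1
  have h3 : min 1 (p.cenX m k) ≤ 1 := min_le_left _ _
  linarith [p.gap_pos m]

/-- The fold identifies the two halves of the interval, so the image has half-length `mu * β / 2`
instead of `mu * β`. The point 0 lies on the grid and is excluded. -/
theorem foldFun_near_zero {mu β y : ℝ} (hmu : 0 < mu) (hβ : β < 1) (hy : |y| < β) (hy0 : y ≠ 0) :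
    |foldFun mu y - mu * β / 2| < mu * β / 2 := by
  have h1 : foldFun mu y = mu * |y| := by
    unfold foldFun
    rcases lt_or_gt_of_ne hy0 with h | h
    · rw [if_pos h, abs_of_neg h]; ring
    · rw [abs_of_pos h] at hy ⊢
      rw [if_neg h.not_gt, if_pos (by linarith)]
  have h2 : 0 < |y| := abs_pos.2 hy0
  rw [h1, abs_lt]
  constructor <;> nlinarith

/-- The second coordinate before the possible exchange of coordinates. -/
theorem step_second {m k : ℕ} (hk : k < p.dur m) {y : ℝ}
    (hy : y ∈ Ioo (p.cenY m k - p.halfH m k) (p.cenY m k + p.halfH m k)) (hy0 : y ≠ 0) :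
    (k + 1 < p.dur m → |foldFun p.mu y + p.shift m k - p.cenY m (k + 1)| < p.halfH m (k + 1)) ∧
    (k + 1 = p.dur m → |foldFun p.mu y + p.shift m k - p.cenX (m + 1) 0| < p.halfW (m + 1) 0) := by
  have m0 := p.mu_pos
  have hb := p.hgt_pos m
  have hesc := p.esc_lt_dur m
  have hle := p.hgt_mul_le m
  have l1 := p.one_lt_lam
  obtain ⟨hy1, hy2⟩ := hy
  -- Three phases. While climbing, the lower edge is exactly `(mu ^ (esc m - k))⁻¹`, and the
  -- rectangle stays in 0 < y < 1 without any shift. At `k = esc m` the lower edge is 1, so the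
  -- outer branch acts and the shift centres the image at 0. Afterwards the fold halves.
  rcases lt_trichotomy k (p.esc m) with hlt | heq | hgt
  · refine ⟨fun _ => ?_, fun h => by omega⟩
    have e1 : p.cenY m k = (p.mu ^ (p.esc m - k))⁻¹ + p.hgt m * p.mu ^ k := if_pos hlt.le
    have e2 : p.cenY m (k + 1) = (p.mu ^ (p.esc m - (k + 1)))⁻¹ + p.hgt m * p.mu ^ (k + 1) :=
      if_pos (by omega)
    have e3 : p.halfH m k = p.hgt m * p.mu ^ k := by
      unfold halfH
      rw [Nat.sub_eq_zero_of_le (by omega), pow_zero, div_one]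
    have e4 : p.halfH m (k + 1) = p.hgt m * p.mu ^ (k + 1) := by
      unfold halfH
      rw [Nat.sub_eq_zero_of_le (by omega), pow_zero, div_one]
    have e5 : p.shift m k = 0 := if_pos hlt
    have e6 : (p.mu ^ (p.esc m - k))⁻¹ * p.mu = (p.mu ^ (p.esc m - (k + 1)))⁻¹ := by
      have : p.esc m - k = p.esc m - (k + 1) + 1 := by omega
      rw [this, pow_succ]
      field_simp
    have h1 : (p.mu ^ (p.esc m - (k + 1)))⁻¹ ≤ 1 := inv_le_one_of_one_le₀ (one_le_pow₀ p.one_lt_mu.le)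
    have h2 : p.hgt m * p.mu ^ (k + 1) ≤ p.hgt m * p.mu ^ p.esc m := by
      gcongr
      · exact p.one_lt_mu.le
      · exact hlt
    have h3 : 0 < (p.mu ^ (p.esc m - k))⁻¹ := by positivity
    rw [e1, e3] at hy1 hy2
    have hypos : 0 < y := by linarith
    have hylt : y < 1 := by
      have h4 : y * p.mu < (p.mu ^ (p.esc m - (k + 1)))⁻¹ + 2 * (p.hgt m * p.mu ^ (k + 1)) := by
        have := mul_lt_mul_of_pos_right hy2 m0
        rw [add_mul, add_mul, e6] at this
        rw [pow_succ]
        linarith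
      have h5 := p.lam_le_mu
      by_contra hcon
      nlinarith
    have e7 : foldFun p.mu y = p.mu * y := by
      unfold foldFun
      rw [if_neg hypos.not_gt, if_pos hylt]
    rw [e7, e5, e2, e4, ← e6, pow_succ, abs_lt]
    constructor <;> nlinarith
  · refine ⟨fun _ => ?_, fun h => by omega⟩
    have e1 : p.cenY m k = 1 + p.hgt m * p.mu ^ k := by
      unfold cenY
      rw [if_pos heq.le, heq, Nat.sub_self, pow_zero, inv_one]
    have e2 : p.cenY m (k + 1) = 0 := if_neg (by omega)
    have e3 : p.halfH m k = p.hgt m * p.mu ^ k := by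
      unfold halfH
      rw [Nat.sub_eq_zero_of_le (by omega), pow_zero, div_one]
    have e4 : p.halfH m (k + 1) = p.hgt m * p.mu ^ (k + 1) := by
      unfold halfH
      rw [Nat.sub_eq_zero_of_le (by omega), pow_zero, div_one]
    have e5 : p.shift m k = -(p.mu * p.halfH m k) := by
      unfold shift
      rw [if_neg (by omega), if_pos heq]
    rw [e1, e3] at hy1 hy2
    have e7 : foldFun p.mu y = p.mu * (y - 1) := by
      unfold foldFun
      rw [if_neg (by linarith), if_neg (by linarith)]
    rw [e7, e5, e2, e4, e3, pow_succ, abs_lt]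
    constructor <;> nlinarith
  · have e1 : p.cenY m k = 0 := if_neg (by omega)
    rw [e1] at hy1 hy2
    have hyabs : |y| < p.halfH m k := abs_lt.2 ⟨by linarith, by linarith⟩
    have hfold := foldFun_near_zero m0 (p.halfH_lt_one hk) hyabs hy0
    have e2 : p.hgt m * p.mu ^ (k + 1) / 2 ^ (k + 1 - (p.esc m + 1)) = p.mu * p.halfH m k / 2 := by
      have : k + 1 - (p.esc m + 1) = k - (p.esc m + 1) + 1 := by omega
      unfold halfH
      rw [this, pow_succ, pow_succ]
      field_simp
    constructor
    · intro hk1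
      have e3 : p.cenY m (k + 1) = 0 := if_neg (by omega)
      have e5 : p.shift m k = -(p.mu * p.halfH m k / 2) := by
        unfold shift
        rw [if_neg (by omega), if_neg (by omega), if_pos hk1]
      have e4 : p.halfH m (k + 1) = p.mu * p.halfH m k / 2 := e2
      rw [e3, e4, e5, sub_zero, ← sub_eq_add_neg]
      exact hfold
    · intro hk1
      have e5 : p.shift m k = p.cenX (m + 1) 0 - p.mu * p.halfH m k / 2 := by
        unfold shift
        rw [if_neg (by omega), if_neg (by omega), if_neg (by omega)]
      have e4 : p.halfW (m + 1) 0 = p.mu * p.halfH m k / 2 := by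
        rw [← e2, hk1]
        have : p.dur m - (p.esc m + 1) = p.dur m - 1 - p.esc m := by omega
        rw [this]
        unfold halfW
        rw [pow_zero, mul_one]
        rfl
      have e6 : foldFun p.mu y + (p.cenX (m + 1) 0 - p.mu * p.halfH m k / 2) - p.cenX (m + 1) 0
          = foldFun p.mu y - p.mu * p.halfH m k / 2 := by ring
      rw [e5, e4, e6]
      exact hfold

/-- Horizontally everything is exact: the centres and half-widths scale by `lam`, and at the exit
the abscissa is chosen so that `lam * (exit - 1)` is the next starting ordinate. -/
theorem step_mem {m k : ℕ} (hk : k < p.dur m) {h : ℝ → ℝ} {z : Plane} (hz : z ∈ p.rect m k)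
    (hh : h (z 0) = p.shift m k) (hd : z ∈ (foldingMap p.lam p.mu h).dom ambientRect) :
    (k + 1 < p.dur m → (foldingMap p.lam p.mu h).toFun z ∈ p.rect m (k + 1)) ∧
      (k + 1 = p.dur m → (foldingMap p.lam p.mu h).toFun z ∈ p.rect (m + 1) 0) := by
  have l0 := p.lam_pos
  obtain ⟨-, -, hy0, -⟩ := mem_dom_iff.1 hd
  obtain ⟨s1, s2⟩ := p.step_second hk hz.2 hy0
  obtain ⟨⟨hx1, hx2⟩, -⟩ := hz
  constructor
  · intro hk1
    have hlt : z 0 < 1 := lt_of_lt_of_le hx2 (p.rect_right_le hk1)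
    have e0 : (foldingMap p.lam p.mu h).toFun z = !₂[p.lam * z 0, foldFun p.mu (z 1) + h (z 0)] :=
      if_pos hlt
    obtain ⟨t1, t2⟩ := abs_lt.1 (s1 hk1)
    have e1 : p.cenX m (k + 1) = p.lam * p.cenX m k := by
      have : p.dur m - 1 - k = p.dur m - 1 - (k + 1) + 1 := by omega
      unfold cenX
      rw [this, pow_succ]
      field_simp
    have e2 : p.halfW m (k + 1) = p.lam * p.halfW m k := by
      unfold halfW
      ring
    rw [e0, hh]
    refine ⟨⟨?_, ?_⟩, ?_, ?_⟩
    · change _ < p.lam * z 0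
      rw [e1, e2]; nlinarith
    · change p.lam * z 0 < _
      rw [e1, e2]; nlinarith
    · change _ < foldFun p.mu (z 1) + p.shift m k
      linarith
    · change foldFun p.mu (z 1) + p.shift m k < _
      linarith
  · intro hk1
    have hgt : 1 < z 0 := lt_of_le_of_lt (p.rect_left_ge hk1) hx1
    have e0 : (foldingMap p.lam p.mu h).toFun z
        = !₂[foldFun p.mu (z 1) + h (z 0), p.lam * (z 0 - 1)] := if_neg hgt.not_gt
    obtain ⟨t1, t2⟩ := abs_lt.1 (s2 hk1)
    have hi : p.dur m - 1 - k = 0 := by omega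
    have e1 : p.lam * (p.cenX m k - 1) = p.cenY (m + 1) 0 := by
      have : p.cenX m k = p.exit m := by
        unfold cenX
        rw [hi, pow_zero, div_one]
      rw [this]
      unfold cenY exit
      rw [if_pos (Nat.zero_le _), Nat.sub_zero, pow_zero, mul_one]
      field_simp
      ring
    have e2 : p.lam * p.halfW m k = p.halfH (m + 1) 0 := by
      have e3 : p.hgt (m + 1) = p.wid m * p.lam ^ p.dur m := rfl
      unfold halfW halfH
      rw [e3, ← hk1, Nat.zero_sub, pow_zero, pow_zero, mul_one, div_one, pow_succ]
      ring
    rw [e0, hh]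
    refine ⟨⟨?_, ?_⟩, ?_, ?_⟩
    · change _ < foldFun p.mu (z 1) + p.shift m k
      linarith
    · change foldFun p.mu (z 1) + p.shift m k < _
      linarith
    · change _ < p.lam * (z 0 - 1)
      rw [← e1, ← e2]; nlinarith
    · change p.lam * (z 0 - 1) < _
      rw [← e1, ← e2]; nlinarith

theorem rect_zero_subset : p.rect 0 0 ⊆ ambientRect := by
  have l0 := p.lam_pos
  have m0 := p.mu_pos
  rintro z ⟨hx, hy1, hy2⟩
  have h1 := p.window_bounds' (lt_of_le_of_lt (p.rect_subset_window (p.dur_pos 0) hx)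
    (by linarith [p.winR_pos 0 0]))
  have e : 0 < p.lam ^ (p.dur 0 - 1 - 0) := by positivity
  have hlt := p.rect_right_le (m := 0) (k := 0) (by have := p.esc_lt_dur 0; omega)
  have e1 : p.cenY 0 0 = (p.mu ^ p.esc 0)⁻¹ + p.halfH 0 0 := by
    unfold cenY halfH
    rw [if_pos (Nat.zero_le _)]
    simp
  have h2 : 0 < (p.mu ^ p.esc 0)⁻¹ := by positivity
  have h3 : (p.mu ^ p.esc 0)⁻¹ ≤ 1 := inv_le_one_of_one_le₀ (one_le_pow₀ p.one_lt_mu.le)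
  have h4 : 16 * p.halfH 0 0 ≤ p.lam - 1 := by
    have h5 := p.hgt_mul_le 0
    have h6 : p.hgt 0 ≤ p.hgt 0 * p.mu ^ p.esc 0 :=
      le_mul_of_one_le_right (p.hgt_pos 0).le (one_le_pow₀ p.one_lt_mu.le)
    have h7 := p.halfH_le 0 0
    rw [pow_zero, mul_one] at h7
    linarith
  have h8 := p.lam_le
  refine ⟨⟨?_, ?_⟩, ?_, ?_⟩
  · by_contra hcon
    have : z 0 * p.lam ^ (p.dur 0 - 1 - 0) ≤ 0 :=
      mul_nonpos_of_nonpos_of_nonneg (not_lt.1 hcon) e.le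
    linarith
  · linarith [hx.2]
  · linarith
  · linarith

theorem summable_shift :
    Summable (fun n => |p.shift (p.state n).1 (p.state n).2| /
      p.winR (p.state n).1 (p.state n).2 ^ p.r) ∧
    ∑' n, |p.shift (p.state n).1 (p.state n).2| / p.winR (p.state n).1 (p.state n).2 ^ p.r ≤
      bumpConst p.r p.j₀ p.lam * (1 - p.lam⁻¹)⁻¹ * (p.lam ^ p.N)⁻¹ := by
  have l0 := p.lam_pos
  have l1 := p.one_lt_lam
  have hC : 0 ≤ bumpConst p.r p.j₀ p.lam := by
    have : 0 < p.lam - 1 := by linarith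
    unfold bumpConst
    positivity
  have hb : ∀ n, |p.shift (p.state n).1 (p.state n).2| / p.winR (p.state n).1 (p.state n).2 ^ p.r ≤
      bumpConst p.r p.j₀ p.lam * (p.lam ^ p.N)⁻¹ * p.lam⁻¹ ^ n := by
    intro n
    refine (p.shift_div_le (p.state_lt n)).trans ?_
    rw [mul_assoc]
    refine mul_le_mul_of_nonneg_left ?_ hC
    rw [inv_pow, ← mul_inv, ← pow_add]
    -- The exponent `3 * dur` exceeds `N + n`, since the elapsed time `n` is below the start of the
    -- excursion plus its duration. Hence the costs decay geometrically in `n`.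
    refine inv_anti₀ (by positivity) (pow_le_pow_right₀ l1.le ?_)
    have h1 := p.tstart_add_state n
    have h2 := p.state_lt n
    have h3 := p.three_mul_tstart_le (p.state n).1
    have h4 := p.N_le_dur (p.state n).1
    omega
  have hg : HasSum (fun n => bumpConst p.r p.j₀ p.lam * (p.lam ^ p.N)⁻¹ * p.lam⁻¹ ^ n)
      (bumpConst p.r p.j₀ p.lam * (p.lam ^ p.N)⁻¹ * (1 - p.lam⁻¹)⁻¹) :=
    (hasSum_geometric_of_lt_one (inv_pos.2 l0).le (inv_lt_one_of_one_lt₀ l1)).mul_left _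
  have hs : Summable (fun n => |p.shift (p.state n).1 (p.state n).2| /
      p.winR (p.state n).1 (p.state n).2 ^ p.r) :=
    Summable.of_nonneg_of_le
      (fun n => div_nonneg (abs_nonneg _) (pow_nonneg (p.winR_pos _ _).le _)) hb hg.summable
  refine ⟨hs, (hs.tsum_le_tsum hb hg.summable).trans (le_of_eq ?_)⟩
  rw [hg.tsum_eq]
  ring

/-- The orbit of rectangles is realized by a small perturbation. -/
theorem exists_isRectOrbit {C : ℝ} (hC0 : 0 < C)
    (hC : ∀ (z w H : ℕ → ℝ),
      (∀ n, 0 < w n) → (∀ n, w n ≤ 1) → Summable (fun n => |H n| / w n ^ p.r) →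
      (∀ m n x, |x - z m| < w m → |x - z n| < w n → m = n) →
      ∃ h : ℝ → ℝ, ContDiff ℝ p.r h ∧
        (∀ k ≤ p.r, ∀ x, ‖iteratedFDeriv ℝ k h x‖ ≤ C * ∑' n, |H n| / w n ^ p.r) ∧
        (∀ n x, |x - z n| ≤ w n / 2 → h x = H n) ∧
        (∀ x, h x = 0 ∨ ∃ n, |x - z n| < w n ∧ ∃ t ∈ Icc (0 : ℝ) 1, h x = t * H n)) :
    ∃ (h : ℝ → ℝ) (x y a b H : ℕ → ℝ), ContDiff ℝ p.r h ∧
      (∀ k ≤ p.r, ∀ x, ‖iteratedFDeriv ℝ k h x‖ ≤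
        C * (bumpConst p.r p.j₀ p.lam * (1 - p.lam⁻¹)⁻¹) * (p.lam ^ p.N)⁻¹) ∧
      (∀ x > 1, 0 ≤ h x) ∧ 0 < a 0 ∧ 0 < b 0 ∧
      IsRectOrbit p.lam p.mu h x y a b H p.oddMode := by
  have l0 := p.lam_pos
  obtain ⟨hsum, hle⟩ := p.summable_shift
  obtain ⟨h, hcd, hbd, hval, hsgn⟩ := hC (fun n => p.winC (p.state n).1 (p.state n).2)
    (fun n => p.winR (p.state n).1 (p.state n).2) (fun n => p.shift (p.state n).1 (p.state n).2)
    (fun n => p.winR_pos _ _) (fun n => p.winR_le_one _ _) hsum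
    (fun m n x h1 h2 => p.state_injective
      (p.window_disjoint (p.state_lt m) (p.state_lt n) h1 h2))
  refine ⟨h, fun n => p.cenX (p.state n).1 (p.state n).2, fun n => p.cenY (p.state n).1 (p.state n).2,
    fun n => p.halfW (p.state n).1 (p.state n).2, fun n => p.halfH (p.state n).1 (p.state n).2,
    fun n => p.shift (p.state n).1 (p.state n).2, hcd, ?_, ?_, p.halfW_pos _ _, p.halfH_pos _ _, ?_⟩
  · intro k hk x
    refine (hbd k hk x).trans ?_
    rw [mul_assoc]
    gcongr
  · intro x hx
    rcases hsgn x with h0 | ⟨n, hn, t, ht, hxt⟩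
    · rw [h0]
    -- Only the windows of last steps reach beyond x = 1, and their shifts are nonnegative.
    · have h1 := (p.window_bounds' hn).2
      have hlast : (p.state n).2 + 1 = p.dur (p.state n).1 := by
        by_contra hcon
        have h2 := p.state_lt n
        have h3 : p.lam ≤ p.lam ^ (p.dur (p.state n).1 - 1 - (p.state n).2) :=
          le_self_pow₀ p.one_lt_lam.le (by omega)
        nlinarith
      rw [hxt]
      exact mul_nonneg ht.1 (p.shift_last_nonneg hlast)
  · have hconst : ∀ n, ∀ t ∈ Ioo
        (p.cenX (p.state n).1 (p.state n).2 - p.halfW (p.state n).1 (p.state n).2)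
        (p.cenX (p.state n).1 (p.state n).2 + p.halfW (p.state n).1 (p.state n).2),
        h t = p.shift (p.state n).1 (p.state n).2 := fun n t ht =>
      hval n t (p.rect_subset_window (p.state_lt n) ht)
    refine ⟨fun n => ?_, hconst, fun m n t hm hn => ?_, fun n z hz hd => ?_, p.rect_zero_subset, ?_⟩
    · have hlt := p.state_lt n
      by_cases hk : (p.state n).2 + 1 < p.dur (p.state n).1
      · left
        refine ⟨?_, p.rect_right_le hk⟩
        simp only [oddMode, state, if_pos hk]
      · right
        refine ⟨?_, p.rect_left_ge (by omega)⟩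
        simp only [oddMode, state, if_neg hk, Nat.odd_add_one]
        tauto
    · have w1 := p.winR_pos (p.state m).1 (p.state m).2
      have w2 := p.winR_pos (p.state n).1 (p.state n).2
      exact p.state_injective (p.window_disjoint (p.state_lt m) (p.state_lt n)
        (lt_of_le_of_lt (p.rect_subset_window (p.state_lt m) hm) (by linarith))
        (lt_of_le_of_lt (p.rect_subset_window (p.state_lt n) hn) (by linarith)))
    · have hlt := p.state_lt n
      obtain ⟨s1, s2⟩ := p.step_mem hlt hz (hconst n _ hz.1) hd
      by_cases hk : (p.state n).2 + 1 < p.dur (p.state n).1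
      · have e : p.state (n + 1) = ((p.state n).1, (p.state n).2 + 1) := by
          simp only [state, if_pos hk]
        rw [e]
        exact s1 hk
      · have e : p.state (n + 1) = ((p.state n).1 + 1, 0) := by
          simp only [state, if_neg hk]
        rw [e]
        exact s2 (by omega)
    · simp [oddMode, state]

end OrbitParams

/-! ### Choice of the parameters and conclusion -/

theorem openRect_isOpenRectangle {a b c d : ℝ} (hab : a < b) (hcd : c < d) :
    IsOpenRectangle (openRect a b c d) :=
  ⟨a, b, c, d, hab, hcd, rfl⟩

theorem IsOpenRectangle.isOpen {R : Set Plane} (hR : IsOpenRectangle R) : IsOpen R := by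
  obtain ⟨a, b, c, d, -, -, rfl⟩ := hR
  exact isOpen_openRect a b c d

theorem IsOpenRectangle.nonempty {R : Set Plane} (hR : IsOpenRectangle R) : R.Nonempty := by
  obtain ⟨a, b, c, d, hab, hcd, rfl⟩ := hR
  refine ⟨!₂[(a + b) / 2, (c + d) / 2], ⟨?_, ?_⟩, ?_, ?_⟩ <;> simp <;> linarith

theorem abs_le_of_norm_iteratedFDeriv_le {r : ℕ} {h : ℝ → ℝ} {ε : ℝ}
    (hb : ∀ k ≤ r, ∀ x, ‖iteratedFDeriv ℝ k h x‖ ≤ ε) (x : ℝ) : |h x| ≤ ε := by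
  simpa using hb 0 (Nat.zero_le r) x

theorem abs_deriv_le_of_norm_iteratedFDeriv_le {r : ℕ} (hr : 1 ≤ r) {h : ℝ → ℝ} {ε : ℝ}
    (hb : ∀ k ≤ r, ∀ x, ‖iteratedFDeriv ℝ k h x‖ ≤ ε) (x : ℝ) : |deriv h x| ≤ ε := by
  have := hb 1 hr x
  rwa [norm_iteratedFDeriv_eq_norm_iteratedDeriv, iteratedDeriv_one] at this

/-- For each pair of nearby slopes there is an arbitrarily small perturbation `h` for which the
folding map has a wandering rectangle of Lyapunov irregular points. -/
theorem exists_wandering_perturbation (r : ℕ) {lam mu ε : ℝ} (hlam : 1 < lam)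
    (hpow : lam ^ (64 * (r + 6)) = 2) (hlm : lam < mu) (hmu : mu ≤ lam ^ 2) (hε : 0 < ε)
    (hε' : ε ≤ 1 / 2) :
    ∃ (h : ℝ → ℝ) (R : Set Plane), ContDiff ℝ r h ∧
      (∀ k ≤ r, ∀ x, ‖iteratedFDeriv ℝ k h x‖ ≤ ε) ∧ (∀ x > 1, 0 ≤ h x) ∧ mu ≤ 3 / 2 ∧
      IsOpenRectangle R ∧ R ⊆ ambientRect ∧ (foldingMap lam mu h).IsWandering ambientRect R ∧
      ∀ᵐ z ∂(volume.restrict R), z ∈ (foldingMap lam mu h).regularPoints ambientRect ∧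
        ∀ v : Plane, v ≠ 0 →
          (∃ a b : ℝ, a < b ∧ omegaLimitSeq ((foldingMap lam mu h).lyapSeq z v) = Icc a b) ∧
          omegaLimitSeq ((foldingMap lam mu h).lyapSeq z v) ⊆
            Icc (Real.log lam) (Real.log mu) := by
  have l0 : 0 < lam := by linarith
  obtain ⟨C, hC0, hC⟩ := exists_bump_series r
  -- The order matters: `C` and `j₀` are fixed first, so `K` does not depend on `N`, and `N` can
  -- then be taken so large that `K * (lam ^ N)⁻¹ ≤ ε`.
  obtain ⟨j₀, hj₀⟩ := pow_unbounded_of_one_lt (1 / (lam - 1)) hlam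
  set K := C * (OrbitParams.bumpConst r j₀ lam * (1 - lam⁻¹)⁻¹) with hK
  obtain ⟨N₁, hN₁⟩ := pow_unbounded_of_one_lt (16 / (lam - 1)) hlam
  obtain ⟨N₂, hN₂⟩ := pow_unbounded_of_one_lt (K / ε) hlam
  set N := N₁ + N₂ + 2 * r + 2 * (1 + j₀) with hN
  have hsub : 0 < lam - 1 := by linarith
  have hN₁' : lam ^ N₁ ≤ lam ^ N := pow_le_pow_right₀ hlam.le (by omega)
  have hN₂' : lam ^ N₂ ≤ lam ^ N := pow_le_pow_right₀ hlam.le (by omega)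
  let p : OrbitParams :=
    { r := r, j₀ := j₀, N := N, lam := lam, mu := mu
      one_lt_lam := hlam, lam_le_mu := hlm.le, mu_le_sq := hmu, lam_pow := hpow
      j₀_large := (div_lt_iff₀ hsub).1 hj₀
      N_large := (div_le_iff₀ hsub).1 (hN₁.le.trans hN₁')
      two_mul_r_le := by omega
      two_mul_j₀_le := by omega }
  obtain ⟨h, x, y, a, b, H, hcd, hbd, hpos, ha, hb, O⟩ := p.exists_isRectOrbit hC0 hC
  change IsRectOrbit lam mu h x y a b H p.oddMode at O
  have hbd' : ∀ k ≤ r, ∀ x, ‖iteratedFDeriv ℝ k h x‖ ≤ ε := by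
    intro k hk x
    refine (hbd k hk x).trans ?_
    change K * (lam ^ N)⁻¹ ≤ ε
    rw [← div_eq_mul_inv, div_le_iff₀ (by positivity), mul_comm]
    exact (div_le_iff₀ hε).1 (hN₂.le.trans hN₂')
  have hmu' : mu ≤ 3 / 2 := by
    have h1 : lam ≤ 1 + 1 / 64 := p.lam_le
    nlinarith
  have hmaps := foldingMap_mapsTo hlam hlm.le hmu'
    (fun t => (abs_le_of_norm_iteratedFDeriv_le hbd' t).trans hε') hpos
  refine ⟨h, _, hcd, hbd', hpos, hmu', openRect_isOpenRectangle (by linarith) (by linarith), O.init,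
    O.isWandering, ?_⟩
  filter_upwards [O.ae_regular l0 (by linarith) hmaps] with z hz
  exact ⟨hz.2, fun v hv => O.omegaLimitSeq_lyapSeq hlam hlm p.frequently_count_oddMode_ge
    p.frequently_count_oddMode_le hz.1 hz.2 hv⟩

theorem foldingMap_not_eqOn {lam mu mu' : ℝ} {h h' : ℝ → ℝ} (hmu : mu ≠ mu') :
    ¬ EqOn (foldingMap lam mu h).toFun (foldingMap lam mu' h').toFun
      ((foldingMap lam mu h).dom ambientRect ∩ (foldingMap lam mu' h').dom ambientRect) := by
  intro heq
  have key : ∀ t ∈ Ioo (0 : ℝ) 1, mu * t + h (1 / 2) = mu' * t + h' (1 / 2) := by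
    intro t ht
    have hz : (!₂[1 / 2, t] : Plane) ∈ ambientRect ∧ (!₂[1 / 2, t] : Plane) 0 ≠ 1 ∧
        (!₂[1 / 2, t] : Plane) 1 ≠ 0 ∧ (!₂[1 / 2, t] : Plane) 1 ≠ 1 := by
      refine ⟨⟨⟨?_, ?_⟩, ?_, ?_⟩, ?_, ht.1.ne', ht.2.ne⟩ <;> simp <;> linarith [ht.1, ht.2]
    have h1 := congrArg (fun z : Plane => z 1) (heq ⟨mem_dom_iff.2 hz, mem_dom_iff.2 hz⟩)
    have h2 : ((1 : ℝ) / 2) < 1 := by norm_num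
    simpa [foldingMap, foldFun, ht.1.not_gt, ht.2, h2, inv_lt_one_of_one_lt₀] using h1
  -- Two heights over the same abscissa: subtraction removes the values of `h` and `h'` and compares
  -- the slopes.
  have h1 := key (1 / 4) ⟨by norm_num, by norm_num⟩
  have h2 := key (1 / 2) ⟨by norm_num, by norm_num⟩
  exact hmu (by linarith)

theorem theoremA (r : ℕ) (hr : 1 ≤ r) :
    ∃ (D : Set Plane) (u p : ℕ) (F : ℝ → PiecewiseMap u p) (F₀ : PiecewiseMap u p)
      (R : ℝ → Set Plane) (ρ c : ℝ),
      IsOpenRectangle D ∧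
      -- a family of piecewise expanding maps, converging to another one
      (∀ σ ∈ Ioo (0 : ℝ) 1, IsPiecewiseExpanding r D (F σ)) ∧
      IsPiecewiseExpanding r D F₀ ∧
      CrTendsto r F (𝓝[>] 0) F₀ ∧
      (∀ σ ∈ Ioo (0 : ℝ) 1, ¬ EqOn (F σ).toFun F₀.toFun ((F σ).dom D ∩ F₀.dom D)) ∧
      -- wandering rectangles
      (∀ σ ∈ Ioo (0 : ℝ) 1, IsOpenRectangle (R σ) ∧ R σ ⊆ D ∧ (F σ).IsWandering D (R σ)) ∧
      -- the limit sets are non-trivial closed intervals with infimum at least `ρ`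
      0 < ρ ∧
      (∀ σ ∈ Ioo (0 : ℝ) 1, ∀ᵐ x ∂(volume.restrict (R σ)), x ∈ (F σ).regularPoints D ∧
        ∀ v : Plane, v ≠ 0 →
          (∃ a b : ℝ, a < b ∧ omegaLimitSeq ((F σ).lyapSeq x v) = Icc a b) ∧
          ρ ≤ sInf (omegaLimitSeq ((F σ).lyapSeq x v))) ∧
      -- these intervals converge to the one-point set `{c}`
      (∀ ε > 0, ∀ᶠ σ in 𝓝[>] (0 : ℝ), ∀ᵐ x ∂(volume.restrict (R σ)), ∀ v : Plane, v ≠ 0 →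
        omegaLimitSeq ((F σ).lyapSeq x v) ⊆ Metric.ball c ε) ∧
      -- each map has an observable Lyapunov irregular set
      (∀ σ ∈ Ioo (0 : ℝ) 1, ∃ U ⊆ D, NullMeasurableSet U volume ∧ 0 < volume U ∧
        ∀ x ∈ U, (F σ).IsLyapunovIrregular D x) := by
  obtain ⟨lam, hlam, hpow⟩ : ∃ lam : ℝ, 1 < lam ∧ lam ^ (64 * (r + 6)) = 2 := by
    refine ⟨2 ^ (((64 * (r + 6) : ℕ) : ℝ)⁻¹), Real.one_lt_rpow (by norm_num) (by positivity), ?_⟩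
    exact Real.rpow_inv_natCast_pow (by norm_num) (by omega)
  have l0 : 0 < lam := by linarith
  have hl2 : lam ≤ 3 / 2 := by
    have h1 := one_add_mul_sub_le_pow (a := lam) (by linarith) (64 * (r + 6))
    rw [hpow] at h1
    push_cast at h1
    have : (0 : ℝ) ≤ r := by positivity
    nlinarith
  have hlog : 0 < Real.log lam := Real.log_pos hlam
  -- This choice gives `lam < mu σ ≤ lam ^ 2` on (0, 1) and exponents at most `(1 + σ) * log lam`.
  set mu : ℝ → ℝ := fun σ => lam ^ (1 + σ) with hmu
  have hmu_gt : ∀ σ ∈ Ioo (0 : ℝ) 1, lam < mu σ := fun σ hσ => by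
    have := Real.rpow_lt_rpow_of_exponent_lt hlam (show (1 : ℝ) < 1 + σ by linarith [hσ.1])
    rwa [Real.rpow_one] at this
  have hmu_le : ∀ σ ∈ Ioo (0 : ℝ) 1, mu σ ≤ lam ^ 2 := fun σ hσ => by
    have := Real.rpow_le_rpow_of_exponent_le hlam.le (show 1 + σ ≤ (2 : ℝ) by linarith [hσ.2])
    rwa [Real.rpow_two] at this
  have hmu_log : ∀ σ, Real.log (mu σ) = (1 + σ) * Real.log lam := fun σ => Real.log_rpow l0 _
  -- The factor `σ` gives the convergence; the factor `(lam - 1) / 2` keeps the maps uniformly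
  -- expanding for all σ < 1.
  set ε : ℝ → ℝ := fun σ => σ * ((lam - 1) / 2) with hε
  have hε_pos : ∀ σ ∈ Ioo (0 : ℝ) 1, 0 < ε σ := fun σ hσ => mul_pos hσ.1 (by linarith)
  have hε_le : ∀ σ ∈ Ioo (0 : ℝ) 1, ε σ ≤ (lam - 1) / 2 := fun σ hσ =>
    mul_le_of_le_one_left (by linarith) hσ.2.le
  have hex : ∀ σ : ℝ, ∃ (h : ℝ → ℝ) (R : Set Plane), σ ∈ Ioo (0 : ℝ) 1 → ContDiff ℝ r h ∧
      (∀ k ≤ r, ∀ x, ‖iteratedFDeriv ℝ k h x‖ ≤ ε σ) ∧ (∀ x > 1, 0 ≤ h x) ∧ mu σ ≤ 3 / 2 ∧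
      IsOpenRectangle R ∧ R ⊆ ambientRect ∧ (foldingMap lam (mu σ) h).IsWandering ambientRect R ∧
      ∀ᵐ z ∂(volume.restrict R), z ∈ (foldingMap lam (mu σ) h).regularPoints ambientRect ∧
        ∀ v : Plane, v ≠ 0 →
          (∃ a b : ℝ, a < b ∧ omegaLimitSeq ((foldingMap lam (mu σ) h).lyapSeq z v) = Icc a b) ∧
          omegaLimitSeq ((foldingMap lam (mu σ) h).lyapSeq z v) ⊆
            Icc (Real.log lam) (Real.log (mu σ)) := by
    intro σ
    by_cases hσ : σ ∈ Ioo (0 : ℝ) 1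
    · obtain ⟨h, R, hh⟩ := exists_wandering_perturbation r hlam hpow (hmu_gt σ hσ) (hmu_le σ hσ)
        (hε_pos σ hσ) ((hε_le σ hσ).trans (by linarith))
      exact ⟨h, R, fun _ => hh⟩
    -- Irrelevant values outside the parameter interval.
    · exact ⟨0, ∅, fun h => absurd h hσ⟩
  choose h R hhR using hex
  have hmem : ∀ᶠ σ in 𝓝[>] (0 : ℝ), σ ∈ Ioo (0 : ℝ) 1 := Ioo_mem_nhdsGT one_pos
  have hderiv : ∀ σ ∈ Ioo (0 : ℝ) 1, ∀ x, |deriv (h σ) x| ≤ (lam - 1) / 2 := fun σ hσ x =>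
    (abs_deriv_le_of_norm_iteratedFDeriv_le hr (hhR σ hσ).2.1 x).trans (hε_le σ hσ)
  have hirr : ∀ σ ∈ Ioo (0 : ℝ) 1, ∀ᵐ x ∂(volume.restrict (R σ)),
      (foldingMap lam (mu σ) (h σ)).IsLyapunovIrregular ambientRect x := by
    intro σ hσ
    filter_upwards [(hhR σ hσ).2.2.2.2.2.2.2] with x hx
    have hv : (EuclideanSpace.single (0 : Fin 2) (1 : ℝ) : Plane) ≠ 0 := by
      simp
    refine ⟨hx.1, _, hv, ?_⟩
    rintro ⟨c, hc⟩
    obtain ⟨⟨a, b, hab, h1⟩, -⟩ := hx.2 _ hv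
    rw [h1] at hc
    have ha : a ∈ ({c} : Set ℝ) := hc ▸ left_mem_Icc.2 hab.le
    have hb : b ∈ ({c} : Set ℝ) := hc ▸ right_mem_Icc.2 hab.le
    rw [mem_singleton_iff] at ha hb
    exact hab.ne (ha.trans hb.symm)
  refine ⟨ambientRect, 7, 6, fun σ => foldingMap lam (mu σ) (h σ), foldingMap lam lam 0, R,
    Real.log lam, Real.log lam, openRect_isOpenRectangle (by norm_num) (by norm_num), ?_, ?_, ?_,
    ?_, ?_, hlog, ?_, ?_, ?_⟩
  · intro σ hσ
    obtain ⟨h1, h2, h3, h4, -⟩ := hhR σ hσ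
    exact foldingMap_isPiecewiseExpanding hr hlam (hmu_gt σ hσ).le h4 h1 (hderiv σ hσ)
      (fun x => (abs_le_of_norm_iteratedFDeriv_le h2 x).trans
        ((hε_le σ hσ).trans (by linarith))) h3
  · have h0 : ContDiff ℝ r (0 : ℝ → ℝ) := contDiff_const
    refine foldingMap_isPiecewiseExpanding hr hlam le_rfl hl2 h0 (fun x => ?_) (fun x => ?_)
      fun x _ => le_rfl
    · have : deriv (0 : ℝ → ℝ) x = 0 := deriv_const x (0 : ℝ)
      rw [this, abs_zero]
      linarith
    · simp
  · refine foldingMap_crTendsto hr hlam (ε := ε) (hmem.mono fun σ hσ => (hmu_gt σ hσ).le) ?_ ?_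
      (hmem.mono fun σ hσ => (hhR σ hσ).1) (hmem.mono hderiv)
      (hmem.mono fun σ hσ => (hhR σ hσ).2.1)
    · have hc : Continuous mu := (Real.continuous_const_rpow l0.ne').comp (by fun_prop)
      have := hc.tendsto 0
      simp only [hmu, add_zero, Real.rpow_one] at this
      exact this.mono_left nhdsWithin_le_nhds
    · have hc : Continuous ε := by fun_prop
      have := hc.tendsto 0
      simp only [hε, zero_mul] at this
      exact this.mono_left nhdsWithin_le_nhds
  · exact fun σ hσ => foldingMap_not_eqOn (hmu_gt σ hσ).ne'
  · intro σ hσ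
    obtain ⟨-, -, -, -, h5, h6, h7, -⟩ := hhR σ hσ
    exact ⟨h5, h6, h7⟩
  · intro σ hσ
    filter_upwards [(hhR σ hσ).2.2.2.2.2.2.2] with x hx
    refine ⟨hx.1, fun v hv => ⟨(hx.2 v hv).1, ?_⟩⟩
    obtain ⟨⟨a, b, hab, h1⟩, h2⟩ := hx.2 v hv
    rw [h1] at h2 ⊢
    rw [csInf_Icc hab.le]
    exact (h2 (left_mem_Icc.2 hab.le)).1
  · intro δ hδ
    have hlim : ∀ᶠ σ in 𝓝[>] (0 : ℝ), σ * Real.log lam < δ := by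
      have hc : Continuous fun σ : ℝ => σ * Real.log lam := by fun_prop
      have := hc.tendsto 0
      simp only [zero_mul] at this
      exact (this.mono_left nhdsWithin_le_nhds).eventually (gt_mem_nhds hδ)
    filter_upwards [hmem, hlim] with σ hσ hσδ
    filter_upwards [(hhR σ hσ).2.2.2.2.2.2.2] with x hx v hv t ht
    obtain ⟨h1, h2⟩ := (hx.2 v hv).2 ht
    rw [hmu_log] at h2
    rw [Metric.mem_ball, Real.dist_eq, abs_lt]
    constructor <;> linarith
  · intro σ hσ
    obtain ⟨-, -, -, -, h5, h6, -⟩ := hhR σ hσ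
    -- Null measurability follows from almost everywhere equality with the open rectangle, without
    -- studying the irregular set itself.
    set U := {x ∈ R σ | (foldingMap lam (mu σ) (h σ)).IsLyapunovIrregular ambientRect x} with hU
    have hae : U =ᵐ[volume] R σ := by
      have h1 := hirr σ hσ
      rw [ae_restrict_iff' h5.isOpen.measurableSet] at h1
      rw [eventuallyEq_set]
      filter_upwards [h1] with x hx
      exact ⟨fun h => h.1, fun h => ⟨h, hx h⟩⟩
    refine ⟨U, (sep_subset _ _).trans h6,
      h5.isOpen.measurableSet.nullMeasurableSet.congr hae.symm, ?_, fun x hx => hx.2⟩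
    rw [measure_congr hae]
    exact h5.isOpen.measure_pos volume h5.nonempty
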